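/- **Theorem 3.1.** Let $X$ and $U$ be Banach spaces over $\mathbb K\in\{\mathbb R,\mathbb C\}$, let $A$ be the generator of a strongly continuous semigroup $(T(t))_{t\ge 0}$ on $X$, and let $\tau>0$, $\omega\ge 0$. *Extrapolation space.* Fix $\lambda\in\varrho(A)$ and let $X_{-1}$ be the completion of $X$ with respect to the norm $\|x\|_{-1}=\|(\lambda I-A)^{-1}x\|$; regard $X\subset X_{-1}$. Let $T_{-1}(t)\in\mathcal L(X_{-1})$ be the continuous extension of $T(t)$ and $A_{-1}\in\mathcal L(X,X_{-1})$ the continuous extension of $A:\mathrm{dom}(A)\to X\subset X_{-1}$. *Desch–Schappacher perturbations.* For $t_0>0$ let $\mathcal X_{t_0}$ be the Banach space of all strongly continuous functions $Q:[0,t_0]\to\mathcal L(X)$ with the norm $\|Q\|_\infty=\sup_{0\le t\le t_0}\|Q(t)\|$. For $\Psi\in\mathcal L(X,X_{-1})$ put $$(V_\Psi Q)(t)x=\int_0^t T_{-1}(t-s)\,\Psi\, Q(s)x\,\mathrm ds\in X_{-1},\qquad Q\in\mathcal X_{t_0},\ t\in[0,t_0],\ x\in X,$$ and let $\mathcal S^{\rm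 DS}_{t_0}$ be the set of all $\Psi\in\mathcal L(X,X_{-1})$ such that $V_\Psi$ is a bounded linear operator from $\mathcal X_{t_0}$ to itself with $\|V_\Psi\|_{\mathcal L(\mathcal X_{t_0})}<1$. *Sampled-data system.* Let $B\in\mathcal L(U,X_{-1})$ and $F\in\mathcal L(X,U)$. If $D\in\mathcal S^{\rm DS}_{t_0}$ for some $t_0>0$, then the operator $A_Dx=(A_{-1}+D)x$ with domain $\{x\in X:(A_{-1}+D)x\in X\}$ generates a strongly continuous semigroup $(T_D(t))_{t\ge0}$ on $X$; let $(T_D)_{-1}(t)\in\mathcal L(X_{-1})$ be the continuous extension of $T_D(t)$. The solution of the sampled-data system $$\dot x(t)=(A+D)x(t)+Bu(t)\ (t\ge0),\quad x(0)=x^0\in X,\qquad u(t)=Fx(k\tau)\ \text{ for } k\tau\le t<(k+1)\tau,\ k=0,1,2,\dots$$ is the function $x:[0,\infty)\to X$ given recursively by $x(0)=x^0$ and $$x(k\tau+t)=T_D(t)x(k\tau)+\int_0^t (T_D)_{-1}(s)BFx(k\tau)\,\mathrm ds,\qquad t\in(0,\tau],\ k=0,1,2,\dots,$$ where the integral is taken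 in $X_{-1}$ and has its value in $X$. The system is called exponentially stable with decay rate greater than $\omega$ if there are constants $M\ge1$ and $\widetilde\omega>\omega$ such that, for every $x^0\in X$, its solution satisfies $\|x(t)\|\le Me^{-\widetilde\omega t}\|x^0\|$ for all $t\ge0$. *Claim.* Let $D_0\in\mathcal S^{\rm DS}_{t_0}$ for some $t_0>0$. If the nominal sampled-data system ($D=0$) is exponentially stable with decay rate greater than $\omega$, then there exists $c^*>0$ such that for every $c\in[0,c^*]$ the perturbed sampled-data system with $D=cD_0$ is also exponentially stable with decay rate greater than $\omega$ (in particular, $cD_0\in\mathcal S^{\rm DS}_{t_1}$ for some $t_1>0$). -/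

import Mathlib

open Filter Topology Set

noncomputable section

namespace SampledData

variable {𝕜 : Type*} [RCLike 𝕜]
variable {X : Type*} [NormedAddCommGroup X] [NormedSpace 𝕜 X]
variable {U : Type*} [NormedAddCommGroup U] [NormedSpace 𝕜 U]

/-! ### Strongly continuous semigroups, generators, resolvents -/

/-- `T` restricted to `[0, ∞)` is a strongly continuous semigroup of bounded operators.
The values of `T` at negative times are irrelevant. -/
structure IsC0Semigroup (T : ℝ → X →L[𝕜] X) : Prop where
  map_zero : T 0 = ContinuousLinearMap.id 𝕜 X
  map_add : ∀ s t : ℝ, 0 ≤ s → 0 ≤ t → T (s + t) = (T s).comp (T t)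
  continuousOn : ∀ x : X, ContinuousOn (fun t => T t x) (Ici 0)

/-- `A` is the (infinitesimal) generator of the strongly continuous semigroup `T`:
`x ∈ dom A` and `A x = y` iff `(T(h)x - x)/h → y` as `h ↓ 0`. -/
structure Generates (A : X →ₗ.[𝕜] X) (T : ℝ → X →L[𝕜] X) : Prop where
  isC0Semigroup : IsC0Semigroup T
  mem_graph_iff : ∀ x y : X, (x, y) ∈ A.graph ↔
    Tendsto (fun h : ℝ => ((h : 𝕜))⁻¹ • (T h x - x)) (𝓝[>] 0) (𝓝 y)

/-- The bounded operator `R` is the (two-sided) inverse of `lam I - A : dom A → X`. -/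
def IsResolvent (A : X →ₗ.[𝕜] X) (lam : 𝕜) (R : X →L[𝕜] X) : Prop :=
  (∀ y : X, ∃ h : R y ∈ A.domain, lam • R y - A ⟨R y, h⟩ = y) ∧
    ∀ x : A.domain, R (lam • (x : X) - A x) = x

/-- The resolvent set `ϱ(A)` of an unbounded operator. -/
def opResolventSet (A : X →ₗ.[𝕜] X) : Set 𝕜 := {lam | ∃ R, IsResolvent A lam R}

open Classical in
/-- `(lam I - A)⁻¹` for `lam ∈ ϱ(A)` (and `0` for other `lam`). -/
def opResolvent (A : X →ₗ.[𝕜] X) (lam : 𝕜) : X →L[𝕜] X :=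
  if h : ∃ R, IsResolvent A lam R then h.choose else 0

/-! ### The extrapolation space -/

/-- The vector space `X`, to be endowed with the norm `x ↦ ‖(lam I - A)⁻¹ x‖`. -/
def PreExtrap (_A : X →ₗ.[𝕜] X) (_lam : 𝕜) : Type _ := X

section PreExtrap
variable (A : X →ₗ.[𝕜] X) (lam : 𝕜)

instance : AddCommGroup (PreExtrap A lam) := inferInstanceAs (AddCommGroup X)

instance : Module 𝕜 (PreExtrap A lam) := inferInstanceAs (Module 𝕜 X)

/-- The identity map of `X`, with values in `PreExtrap A lam`. -/
def toPre : X ≃ₗ[𝕜] PreExtrap A lam := LinearEquiv.refl 𝕜 X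

/-- The resolvent `(lam I - A)⁻¹`, as a linear map on `PreExtrap A lam`. -/
def preResolvent : PreExtrap A lam →ₗ[𝕜] X :=
  (opResolvent A lam).toLinearMap.comp (toPre A lam).symm.toLinearMap

/-- The norm `‖x‖₋₁ = ‖(lam I - A)⁻¹ x‖`. -/
instance : SeminormedAddCommGroup (PreExtrap A lam) :=
  SeminormedAddCommGroup.induced (PreExtrap A lam) X (preResolvent A lam)

instance : NormedSpace 𝕜 (PreExtrap A lam) :=
  NormedSpace.induced 𝕜 (PreExtrap A lam) X (preResolvent A lam)

/-- The extrapolation space `X₋₁` associated with `A`: the completion of `X` with respect to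
the norm `x ↦ ‖(lam I - A)⁻¹ x‖`. It is meant to be used with `lam ∈ ϱ(A)`. -/
def Extrap : Type _ := UniformSpace.Completion (PreExtrap A lam)

instance : NormedAddCommGroup (Extrap A lam) :=
  inferInstanceAs (NormedAddCommGroup (UniformSpace.Completion (PreExtrap A lam)))

instance : NormedSpace 𝕜 (Extrap A lam) :=
  inferInstanceAs (NormedSpace 𝕜 (UniformSpace.Completion (PreExtrap A lam)))

instance : CompleteSpace (Extrap A lam) :=
  inferInstanceAs (CompleteSpace (UniformSpace.Completion (PreExtrap A lam)))

/-- The underlying real normed space, needed for Bochner integrals. -/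
instance : NormedSpace ℝ (Extrap A lam) := NormedSpace.restrictScalars ℝ 𝕜 (Extrap A lam)

theorem norm_toPre (x : X) : ‖toPre A lam x‖ = ‖opResolvent A lam x‖ := rfl

/-- The canonical continuous embedding of `X` into `X₋₁`. -/
def incl : X →L[𝕜] Extrap A lam :=
  (UniformSpace.Completion.toComplL (𝕜 := 𝕜) (E := PreExtrap A lam)).comp
    ((toPre A lam).toLinearMap.mkContinuous ‖opResolvent A lam‖
      (fun x => (opResolvent A lam).le_opNorm x))

theorem norm_incl (x : X) : ‖incl A lam x‖ = ‖opResolvent A lam x‖ :=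
  UniformSpace.Completion.norm_coe (toPre A lam x)

theorem denseRange_incl : DenseRange (incl A lam) :=
  UniformSpace.Completion.denseRange_coe (α := PreExtrap A lam)

end PreExtrap

open Classical in
/-- The continuous extension of `S ∈ L(X)` to `X₋₁`. As `X` is dense in `X₋₁` there is at most
one; the value is `0` if there is none. For a semigroup `T`, `T₋₁(t)` is
`extendOp A lam (T t)`. -/
def extendOp (A : X →ₗ.[𝕜] X) (lam : 𝕜) (S : X →L[𝕜] X) : Extrap A lam →L[𝕜] Extrap A lam :=
  if h : ∃ S' : Extrap A lam →L[𝕜] Extrap A lam, ∀ x, S' (incl A lam x) = incl A lam (S x)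
  then h.choose else 0

open Classical in
/-- `A₋₁ ∈ L(X, X₋₁)`, the unique continuous extension of `A : dom A → X ⊆ X₋₁` (unique because
the domain of a generator is dense). -/
def extendGen (A : X →ₗ.[𝕜] X) (lam : 𝕜) : X →L[𝕜] Extrap A lam :=
  if h : ∃ A' : X →L[𝕜] Extrap A lam, ∀ x : A.domain, A' x = incl A lam (A x)
  then h.choose else 0

/-! ### Desch–Schappacher perturbations -/

/-- The space of all functions `[0, t₀] → L(X)` that are continuous for the strong operator
topology, as a subspace of all functions. -/
def strongContSubmodule (𝕜 X : Type*) [RCLike 𝕜] [NormedAddCommGroup X] [NormedSpace 𝕜 X]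
    (t₀ : ℝ) : Submodule 𝕜 (Icc (0 : ℝ) t₀ → X →L[𝕜] X) where
  carrier := {Q | ∀ x : X, Continuous fun t => Q t x}
  add_mem' := fun hP hQ x => (hP x).add (hQ x)
  zero_mem' := fun _ => continuous_const
  smul_mem' := fun c _ hQ x => (hQ x).const_smul c

/-- The space of strongly continuous functions `[0, t₀] → L(X)`, to be endowed with the
supremum norm. -/
def StrongCont (𝕜 X : Type*) [RCLike 𝕜] [NormedAddCommGroup X] [NormedSpace 𝕜 X]
    (t₀ : ℝ) : Type _ := strongContSubmodule 𝕜 X t₀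

namespace StrongCont
variable {t₀ : ℝ}

instance : AddCommGroup (StrongCont 𝕜 X t₀) :=
  inferInstanceAs (AddCommGroup (strongContSubmodule 𝕜 X t₀))

instance : Module 𝕜 (StrongCont 𝕜 X t₀) :=
  inferInstanceAs (Module 𝕜 (strongContSubmodule 𝕜 X t₀))

instance : CoeFun (StrongCont 𝕜 X t₀) (fun _ => Icc (0 : ℝ) t₀ → X →L[𝕜] X) :=
  ⟨fun Q => Q.1⟩

/-- The function on `ℝ` that is `Q` on `[0, t₀]` and `0` elsewhere. -/
def toReal (Q : StrongCont 𝕜 X t₀) (s : ℝ) : X →L[𝕜] X :=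
  open Classical in if h : s ∈ Icc (0 : ℝ) t₀ then Q ⟨s, h⟩ else 0

/-- The supremum norm. -/
instance : Norm (StrongCont 𝕜 X t₀) := ⟨fun Q => ⨆ t, ‖Q t‖⟩

theorem norm_def (Q : StrongCont 𝕜 X t₀) : ‖Q‖ = ⨆ t, ‖Q t‖ := rfl

/-- By the uniform boundedness principle the supremum in the norm is over a bounded set. -/
theorem bddAbove [CompleteSpace X] (Q : StrongCont 𝕜 X t₀) :
    BddAbove (range fun t => ‖Q t‖) := by
  obtain ⟨C, hC⟩ := banach_steinhaus (g := fun t => Q t) (fun x => by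
    obtain ⟨C, hC⟩ := (isCompact_range (Q.2 x).norm).bddAbove
    exact ⟨C, fun t => hC ⟨t, rfl⟩⟩)
  exact ⟨C, by rintro _ ⟨t, rfl⟩; exact hC t⟩

theorem norm_core [CompleteSpace X] : NormedSpace.Core 𝕜 (StrongCont 𝕜 X t₀) where
  norm_nonneg Q := Real.iSup_nonneg fun t => norm_nonneg _
  norm_smul c Q := by
    rw [norm_def, norm_def, Real.mul_iSup_of_nonneg (norm_nonneg c)]
    exact congrArg iSup (funext fun t => norm_smul c (Q t))
  norm_triangle P Q := by
    refine Real.iSup_le (fun t => ?_)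
      (add_nonneg (Real.iSup_nonneg fun t => norm_nonneg _)
        (Real.iSup_nonneg fun t => norm_nonneg _))
    exact (norm_add_le (P t) (Q t)).trans
      (add_le_add (le_ciSup P.bddAbove t) (le_ciSup Q.bddAbove t))
  norm_eq_zero_iff Q := by
    constructor
    · intro h
      refine Subtype.ext (funext fun t => ?_)
      exact norm_le_zero_iff.1 ((le_ciSup Q.bddAbove t).trans h.le)
    · rintro rfl
      rw [norm_def]
      have h0 : (fun t => ‖(0 : StrongCont 𝕜 X t₀) t‖) = fun _ => (0 : ℝ) :=
        funext fun t => norm_zero (E := X →L[𝕜] X)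
      rw [h0]
      exact Real.iSup_const_zero

instance [CompleteSpace X] : NormedAddCommGroup (StrongCont 𝕜 X t₀) :=
  NormedAddCommGroup.ofCore norm_core

instance [CompleteSpace X] : NormedSpace 𝕜 (StrongCont 𝕜 X t₀) :=
  NormedSpace.ofCore norm_core

end StrongCont

/-- `(V_Ψ Q)(t) x = ∫₀ᵗ T₋₁(t - s) Ψ Q(s) x ds`, an element of `X₋₁`. -/
def volterra (A : X →ₗ.[𝕜] X) (lam : 𝕜) (T : ℝ → X →L[𝕜] X) {t₀ : ℝ}
    (Ψ : X →L[𝕜] Extrap A lam) (Q : StrongCont 𝕜 X t₀) (t : ℝ) (x : X) : Extrap A lam :=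
  ∫ s in (0 : ℝ)..t, extendOp A lam (T (t - s)) (Ψ (Q.toReal s x))

/-- The class of Desch–Schappacher perturbations: those `Ψ ∈ L(X, X₋₁)` for which the abstract
Volterra operator `V_Ψ` is a bounded operator of norm `< 1` on the Banach space of strongly
continuous functions `[0, t₀] → L(X)`. -/
def DeschSchappacher [CompleteSpace X] (A : X →ₗ.[𝕜] X) (lam : 𝕜) (T : ℝ → X →L[𝕜] X) (t₀ : ℝ) :
    Set (X →L[𝕜] Extrap A lam) :=
  {Ψ | ∃ V : StrongCont 𝕜 X t₀ →L[𝕜] StrongCont 𝕜 X t₀,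
    (∀ (Q : StrongCont 𝕜 X t₀) (t : Icc (0 : ℝ) t₀) (x : X),
      incl A lam (V Q t x) = volterra A lam T Ψ Q t x) ∧ ‖V‖ < 1}

/-- The operator `A_D x = (A₋₁ + D) x` with domain `{x ∈ X : (A₋₁ + D) x ∈ X}`, given by its
graph `{(x, y) ∈ X × X : (A₋₁ + D) x = y in X₋₁}`. -/
def perturbedGen (A : X →ₗ.[𝕜] X) (lam : 𝕜) (D : X →L[𝕜] Extrap A lam) : X →ₗ.[𝕜] X :=
  Submodule.toLinearPMap
    (LinearMap.eqLocus
      ((extendGen A lam + D).toLinearMap.comp (LinearMap.fst 𝕜 X X))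
      ((incl A lam).toLinearMap.comp (LinearMap.snd 𝕜 X X)))

/-! ### The sampled-data system -/

/-- `x : [0, ∞) → X` is the solution of
`x'(t) = (A + D) x(t) + B u(t)`, `x(0) = x0`, `u(t) = F x(kτ)` for `kτ ≤ t < (k+1)τ`, where `TD` is
the semigroup generated by `A_D`: for `t ∈ (0, τ]` and `k = 0, 1, 2, …`,
`x(kτ + t) = TD(t) x(kτ) + ∫₀ᵗ TD₋₁(s) B F x(kτ) ds`.
The integral is taken in `X₋₁`, and the identity says in particular that its value is in `X`. -/
structure IsSolution (A : X →ₗ.[𝕜] X) (lam : 𝕜) (TD : ℝ → X →L[𝕜] X)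
    (B : U →L[𝕜] Extrap A lam) (F : X →L[𝕜] U) (τ : ℝ) (x0 : X) (x : ℝ → X) : Prop where
  init : x 0 = x0
  step : ∀ (k : ℕ) (t : ℝ), 0 < t → t ≤ τ →
    incl A lam (x (k * τ + t)) = incl A lam (TD t (x (k * τ))) +
      ∫ s in (0 : ℝ)..t, extendOp A lam (TD s) (B (F (x (k * τ))))

/-- The sampled-data system with the Desch–Schappacher perturbation `D` is exponentially stable
with decay rate greater than `ω`. Here `A` is the generator of `T`, and the semigroup `TD`
generated by `A_D` as well as the solutions (on `[0, ∞)`) are unique. -/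
def ExpStable [CompleteSpace X] (A : X →ₗ.[𝕜] X) (lam : 𝕜) (T : ℝ → X →L[𝕜] X)
    (D : X →L[𝕜] Extrap A lam) (B : U →L[𝕜] Extrap A lam) (F : X →L[𝕜] U) (τ ω : ℝ) : Prop :=
  (∃ t₀ > 0, D ∈ DeschSchappacher A lam T t₀) ∧
  ∃ TD : ℝ → X →L[𝕜] X, Generates (perturbedGen A lam D) TD ∧
  ∃ M : ℝ, 1 ≤ M ∧ ∃ ω' : ℝ, ω < ω' ∧ ∀ x0 : X,
    (∃ x : ℝ → X, IsSolution A lam TD B F τ x0 x) ∧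
    ∀ x : ℝ → X, IsSolution A lam TD B F τ x0 x →
      ∀ t : ℝ, 0 ≤ t → ‖x t‖ ≤ M * Real.exp (-ω' * t) * ‖x0‖

end SampledData

end

noncomputable section

namespace SampledData

variable {𝕜 : Type*} [RCLike 𝕜]
variable {X : Type*} [NormedAddCommGroup X] [NormedSpace 𝕜 X]
variable {U : Type*} [NormedAddCommGroup U] [NormedSpace 𝕜 U]

/-! ### Strongly continuous operator families -/

/-! The extrapolation space is eliminated first. With `R = (λ - A)⁻¹`, the extended resolvent is an
isometric isomorphism of `X₋₁` onto `X` (`extrapEquiv`). Under it the embedding of `X` becomes `R`,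
`T₋₁(t)` becomes `T(t)`, `A₋₁` becomes `λR - 1`, and `D`, `B` become bounded operators `K`, `b` with
values in `X`. Every identity in `X₋₁` turns into one between bounded operators on `X`.

Desch–Schappacher theory: `1 - V` is invertible by a Neumann series, so `S = T + VS` has a solution
on `[0, t₀]`. Uniqueness for the homogeneous equation, applied to suitable defects, yields the
semigroup law and identifies the generator as `A_D`. For `cD` the Volterra operator is `cV`, hence
`‖S - T‖ = O(c)` on `[0, t₀]`, and on `[0, τ]` after taking powers
(`exists_generates_perturbedGen_smul`).

Sampling: since `λ - A_D = (λ - A₋₁)(1 - K)`, the resolvent of `A_D` at `λ` is `HR` with `H = (1 -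
K)⁻¹`, which exists when `K` is replaced by `cK` with `c` small. Integrating the input term shows
that the state `t` units after a sampling time is `E(t) = S(t) + (λ∫₀ᵗS - S(t) + 1) H b F` applied
to the sampled state (`incl_eq_incl_add_integral_iff`). Exponential decay with rate `q` amounts to
`‖E(τ)ᵏ‖ ≤ C e^{-qτk}`.

As `c → 0`, `E(τ)` converges in operator norm to its nominal value, and power stability survives
small perturbations at the price of an arbitrarily small loss of rate
(`exists_norm_pow_le_of_norm_sub_lt`). The strict inequality between `ω` and the nominal rate leaves
room for that loss. -/

theorem exists_norm_le_of_continuousOn [CompleteSpace X] {S : ℝ → X →L[𝕜] X} {s : Set ℝ}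
    (hs : IsCompact s) (hS : ∀ x, ContinuousOn (fun t => S t x) s) :
    ∃ K, 0 ≤ K ∧ ∀ t ∈ s, ‖S t‖ ≤ K := by
  obtain ⟨C, hC⟩ := banach_steinhaus (g := fun t : s => S t) (fun x => by
    obtain ⟨C, hC⟩ := (hs.image_of_continuousOn (hS x).norm).bddAbove
    exact ⟨C, fun t => hC ⟨t, t.2, rfl⟩⟩)
  exact ⟨max C 0, le_max_right _ _, fun t ht => (hC ⟨t, ht⟩).trans (le_max_left _ _)⟩

/-- Local boundedness from the uniform boundedness principle upgrades strong continuity to joint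
continuity. All integrands of convolution type are continuous for this reason. -/
theorem continuous_uncurry_of_continuous [CompleteSpace X] {S : ℝ → X →L[𝕜] X}
    (hS : ∀ x, Continuous fun t => S t x) : Continuous fun p : ℝ × X => S p.1 p.2 := by
  rw [continuous_iff_continuousAt]
  rintro ⟨t₀, x₀⟩
  obtain ⟨K, -, hK⟩ := exists_norm_le_of_continuousOn (isCompact_Icc (a := t₀ - 1) (b := t₀ + 1))
    (fun x => (hS x).continuousOn)
  have h1 : Tendsto (fun p : ℝ × X => S p.1 (p.2 - x₀)) (𝓝 (t₀, x₀)) (𝓝 0) := by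
    have h2 : Tendsto (fun p : ℝ × X => K * ‖p.2 - x₀‖) (𝓝 (t₀, x₀)) (𝓝 0) := by
      have : Continuous fun p : ℝ × X => K * ‖p.2 - x₀‖ := by fun_prop
      simpa using this.tendsto (t₀, x₀)
    refine squeeze_zero_norm' ?_ h2
    have h3 : ∀ᶠ p : ℝ × X in 𝓝 (t₀, x₀), p.1 ∈ Icc (t₀ - 1) (t₀ + 1) :=
      continuous_fst.tendsto (t₀, x₀) (Icc_mem_nhds (by simp) (by simp))
    filter_upwards [h3] with p hp
    exact ((S p.1).le_opNorm _).trans (by gcongr; exact hK _ hp)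
  have h4 : Tendsto (fun p : ℝ × X => S p.1 x₀) (𝓝 (t₀, x₀)) (𝓝 (S t₀ x₀)) :=
    ((hS x₀).comp continuous_fst).tendsto (t₀, x₀)
  have h5 := h1.add h4
  simpa [ContinuousAt] using h5

theorem continuous_apply_of_continuous [CompleteSpace X] {S : ℝ → X →L[𝕜] X}
    (hS : ∀ x, Continuous fun t => S t x) {Y : Type*} [TopologicalSpace Y] {u : Y → ℝ} {f : Y → X}
    (hu : Continuous u) (hf : Continuous f) : Continuous fun y => S (u y) (f y) :=
  (continuous_uncurry_of_continuous hS).comp (hu.prodMk hf)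

namespace IsC0Semigroup
variable {T : ℝ → X →L[𝕜] X}

theorem exists_norm_le [CompleteSpace X] (hT : IsC0Semigroup T) (b : ℝ) :
    ∃ K, 0 ≤ K ∧ ∀ t ∈ Icc 0 b, ‖T t‖ ≤ K :=
  exists_norm_le_of_continuousOn isCompact_Icc
    fun x => (hT.continuousOn x).mono Icc_subset_Ici_self

/-- Freezing the argument at `max t 0` gives functions continuous on all of `ℝ`, although `T` is
arbitrary at negative times. -/
theorem continuous_max (hT : IsC0Semigroup T) (x : X) : Continuous fun t => T (max t 0) x :=
  (hT.continuousOn x).comp_continuous (by fun_prop) fun t => le_max_right t 0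

theorem continuous_max_apply [CompleteSpace X] (hT : IsC0Semigroup T) {Y : Type*}
    [TopologicalSpace Y] {u : Y → ℝ} {f : Y → X} (hu : Continuous u) (hf : Continuous f) :
    Continuous fun y => T (max (u y) 0) (f y) :=
  continuous_apply_of_continuous (S := fun t => T (max t 0)) hT.continuous_max hu hf

theorem apply_zero (hT : IsC0Semigroup T) (x : X) : T 0 x = x := by
  rw [hT.map_zero]; rfl

theorem apply_add (hT : IsC0Semigroup T) {s t : ℝ} (hs : 0 ≤ s) (ht : 0 ≤ t) (x : X) :
    T (s + t) x = T s (T t x) := by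
  rw [hT.map_add s t hs ht]; rfl

theorem apply_comm (hT : IsC0Semigroup T) {s t : ℝ} (hs : 0 ≤ s) (ht : 0 ≤ t) (x : X) :
    T s (T t x) = T t (T s x) := by
  rw [← hT.apply_add hs ht, ← hT.apply_add ht hs, add_comm]

theorem intervalIntegrable (hT : IsC0Semigroup T) {a b : ℝ} (ha : 0 ≤ a) (hb : 0 ≤ b) (x : X) :
    IntervalIntegrable (fun s => T s x) MeasureTheory.volume a b :=
  ((hT.continuousOn x).mono fun _ hs => (le_min ha hb).trans hs.1).intervalIntegrable

theorem integral_max [NormedSpace ℝ X] {t : ℝ} (ht : 0 ≤ t) (x : X) :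
    ∫ s in (0 : ℝ)..t, T (max s 0) x = ∫ s in (0 : ℝ)..t, T s x :=
  intervalIntegral.integral_congr fun s hs => by
    rw [uIcc_of_le ht] at hs
    have h0 : max s 0 = s := max_eq_left hs.1
    rw [h0]

/-- The operator `x ↦ ∫₀ᵗ T(s) x ds`. -/
def integral [CompleteSpace X] [NormedSpace ℝ X] [IsScalarTower ℝ 𝕜 X] (hT : IsC0Semigroup T)
    (t : ℝ) : X →L[𝕜] X :=
  LinearMap.mkContinuousOfExistsBound
    { toFun := fun x => ∫ s in (0 : ℝ)..t, T (max s 0) x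
      map_add' := fun x y => by
        simp only [_root_.map_add]
        exact intervalIntegral.integral_add ((hT.continuous_max x).intervalIntegrable _ _)
          ((hT.continuous_max y).intervalIntegrable _ _)
      map_smul' := fun c x => by
        simp only [map_smul, RingHom.id_apply]
        exact intervalIntegral.integral_smul c _ }
    (by
      obtain ⟨K, hK0, hK⟩ := hT.exists_norm_le |t|
      refine ⟨K * |t - 0|, fun x => ?_⟩
      rw [mul_right_comm]
      refine intervalIntegral.norm_integral_le_of_norm_le_const fun s hs => ?_
      refine ((T (max s 0)).le_opNorm x).trans ?_
      gcongr
      refine hK _ ⟨le_max_right _ _, max_le ?_ (abs_nonneg t)⟩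
      rcases mem_uIoc.1 hs with h | h
      · exact h.2.trans (le_abs_self t)
      · exact h.2.trans (abs_nonneg t))

theorem integral_apply [CompleteSpace X] [NormedSpace ℝ X] [IsScalarTower ℝ 𝕜 X]
    (hT : IsC0Semigroup T) {t : ℝ} (ht : 0 ≤ t) (x : X) :
    hT.integral t x = ∫ s in (0 : ℝ)..t, T s x :=
  integral_max ht x

theorem norm_integral_sub_le [CompleteSpace X] [NormedSpace ℝ X] [IsScalarTower ℝ 𝕜 X]
    {S : ℝ → X →L[𝕜] X} (hS : IsC0Semigroup S) (hT : IsC0Semigroup T) {t δ : ℝ} (ht : 0 ≤ t)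
    (hδ : 0 ≤ δ) (h : ∀ s ∈ Icc 0 t, ‖S s - T s‖ ≤ δ) :
    ‖hS.integral t - hT.integral t‖ ≤ δ * t := by
  refine ContinuousLinearMap.opNorm_le_bound _ (by positivity) fun x => ?_
  rw [sub_apply, hS.integral_apply ht, hT.integral_apply ht,
    ← intervalIntegral.integral_sub (hS.intervalIntegrable le_rfl ht x)
      (hT.intervalIntegrable le_rfl ht x)]
  have := intervalIntegral.norm_integral_le_of_norm_le_const (a := 0) (b := t) (C := δ * ‖x‖)
    (f := fun s => S s x - T s x) fun s hs => by
      rw [uIoc_of_le ht] at hs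
      exact ((S s - T s).le_opNorm x).trans (by gcongr; exact h s ⟨hs.1.le, hs.2⟩)
  refine this.trans (le_of_eq ?_)
  rw [sub_zero, abs_of_nonneg ht]
  ring

end IsC0Semigroup

/-! ### Generators and resolvents -/

theorem ofReal_inv_smul [NormedSpace ℝ X] [IsScalarTower ℝ 𝕜 X] (h : ℝ) (x : X) :
    ((h : 𝕜))⁻¹ • x = h⁻¹ • x := by
  rw [← RCLike.ofReal_inv, RCLike.real_smul_eq_coe_smul (K := 𝕜)]

theorem tendsto_inv_smul_integral [NormedSpace ℝ X] [CompleteSpace X] {f : ℝ → X}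
    (hf : Continuous f) (a : ℝ) :
    Tendsto (fun h : ℝ => h⁻¹ • ∫ s in a..a + h, f s) (𝓝[>] 0) (𝓝 (f a)) := by
  have h1 := intervalIntegral.integral_hasDerivAt_right (hf.intervalIntegrable a a)
    (hf.stronglyMeasurableAtFilter _ _) hf.continuousAt
  have h2 := (hasDerivAt_iff_tendsto_slope_zero.1 h1).mono_left
    (nhdsGT_le_nhdsNE (0 : ℝ))
  simpa using h2

namespace Generates
variable {A : X →ₗ.[𝕜] X} {T : ℝ → X →L[𝕜] X}

/-- `T(h)` shifts the window of integration by `h`, so only two end pieces of length `h` survive in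
the difference; their averages tend to `T(t)x` and `x`. -/
theorem integral_mem_graph [CompleteSpace X] [NormedSpace ℝ X] [IsScalarTower ℝ 𝕜 X]
    (hA : Generates A T) {t : ℝ} (ht : 0 ≤ t) (x : X) :
    (∫ s in (0 : ℝ)..t, T s x, T t x - x) ∈ A.graph := by
  have hT := hA.isC0Semigroup
  rw [hA.mem_graph_iff]
  have hc := hT.continuous_max x
  have h1 := (tendsto_inv_smul_integral hc t).sub (tendsto_inv_smul_integral hc 0)
  simp only [max_eq_left ht, max_self, hT.apply_zero] at h1
  refine h1.congr' ?_
  filter_upwards [self_mem_nhdsWithin] with h hh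
  have hh : 0 < h := hh
  have e1 : T h (∫ s in (0 : ℝ)..t, T s x) = ∫ s in h..t + h, T (max s 0) x := by
    rw [← ContinuousLinearMap.intervalIntegral_comp_comm _ (hT.intervalIntegrable le_rfl ht x)]
    have := intervalIntegral.integral_comp_add_right (a := 0) (b := t)
      (fun s => T (max s 0) x) h
    rw [zero_add] at this
    rw [← this]
    refine intervalIntegral.integral_congr fun s hs => ?_
    rw [uIcc_of_le ht] at hs
    have h0 : max (s + h) 0 = s + h := max_eq_left (by linarith [hs.1])
    rw [h0, ← hT.apply_add hh.le hs.1, add_comm]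
  rw [ofReal_inv_smul, e1, ← IsC0Semigroup.integral_max ht, ← smul_sub, zero_add]
  congr 1
  have i := fun a b : ℝ => hc.intervalIntegrable (μ := MeasureTheory.volume) a b
  rw [← intervalIntegral.integral_add_adjacent_intervals (i h t) (i t (t + h)),
    ← intervalIntegral.integral_add_adjacent_intervals (i 0 h) (i h t)]
  abel

theorem dense_domain [CompleteSpace X] (hA : Generates A T) : Dense (A.domain : Set X) := by
  let _ : NormedSpace ℝ X := NormedSpace.restrictScalars ℝ 𝕜 X
  have _ : IsScalarTower ℝ 𝕜 X := RestrictScalars.isScalarTower ℝ 𝕜 X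
  intro x
  have h1 := tendsto_inv_smul_integral (hA.isC0Semigroup.continuous_max x) 0
  simp only [max_self, hA.isC0Semigroup.apply_zero, zero_add] at h1
  refine mem_closure_of_tendsto h1 ?_
  filter_upwards [self_mem_nhdsWithin] with h hh
  rw [← ofReal_inv_smul (𝕜 := 𝕜), IsC0Semigroup.integral_max (le_of_lt hh)]
  exact A.domain.smul_mem _ (LinearPMap.mem_domain_of_mem_graph
    (hA.integral_mem_graph (le_of_lt hh) x))

theorem apply_mem_graph (hA : Generates A T) {x y : X} (h : (x, y) ∈ A.graph) {t : ℝ}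
    (ht : 0 ≤ t) : (T t x, T t y) ∈ A.graph := by
  rw [hA.mem_graph_iff] at h ⊢
  refine (((T t).continuous.tendsto y).comp h).congr' ?_
  filter_upwards [self_mem_nhdsWithin] with s hs
  have hs : 0 < s := hs
  simp [hA.isC0Semigroup.apply_comm hs.le ht]

/-- A generator determines its semigroup. -/
theorem apply_eq_apply [CompleteSpace X] {S : ℝ → X →L[𝕜] X} (hA : Generates A T)
    (hS : Generates A S) {t : ℝ} (ht : 0 ≤ t) : T t = S t := by
  let _ : NormedSpace ℝ X := NormedSpace.restrictScalars ℝ 𝕜 X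
  have _ : IsScalarTower ℝ 𝕜 X := RestrictScalars.isScalarTower ℝ 𝕜 X
  have cT := hA.isC0Semigroup
  have cS := hS.isC0Semigroup
  refine ContinuousLinearMap.coe_injective ?_
  refine LinearMap.coe_injective ?_
  refine (T t).continuous.ext_on hA.dense_domain (S t).continuous fun x hx => ?_
  have hxg : (x, A ⟨x, hx⟩) ∈ A.graph := A.mem_graph ⟨x, hx⟩
  -- This path runs from `T(t)x` at `0` to `S(t)x` at `t`. Its right derivative vanishes: both
  -- semigroups have the same derivative on the domain, and the outer factor `T(t - u)` stays
  -- bounded.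
  let f : ℝ → X := fun s => T (max (t - s) 0) (S (max s 0) x)
  have hf : Continuous f :=
    cT.continuous_max_apply (by fun_prop) (cS.continuous_max x)
  obtain ⟨K, hK0, hK⟩ := cT.exists_norm_le t
  have key : f t = f 0 := by
    refine constant_of_has_deriv_right_zero (a := 0) (b := t) hf.continuousOn (fun s hs => ?_) t
      ⟨ht, le_rfl⟩
    rw [← hasDerivWithinAt_Ioi_iff_Ici, hasDerivWithinAt_iff_tendsto_slope' (by simp)]
    have hy := hS.apply_mem_graph hxg hs.1
    set y := S s x
    have h1 := ((hS.mem_graph_iff _ _).1 hy).sub ((hA.mem_graph_iff _ _).1 hy)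
    rw [sub_self] at h1
    have h2 : Tendsto (fun u : ℝ => u - s) (𝓝[>] s) (𝓝[>] 0) := by
      refine tendsto_nhdsWithin_iff.2 ⟨?_, ?_⟩
      · refine Tendsto.mono_left ?_ nhdsWithin_le_nhds
        simpa using (continuous_id.sub continuous_const).tendsto (f := fun u : ℝ => u - s) s
      · filter_upwards [self_mem_nhdsWithin] with u hu
        exact mem_Ioi.2 (sub_pos.2 (mem_Ioi.1 hu))
    have h3 := ((h1.comp h2).norm.const_mul K)
    rw [norm_zero, mul_zero] at h3
    refine squeeze_zero_norm' ?_ h3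
    filter_upwards [Ioo_mem_nhdsGT hs.2] with u hu
    have hus : 0 ≤ u - s := (sub_pos.2 hu.1).le
    have hu0 : 0 ≤ u := hs.1.trans hu.1.le
    have htu : 0 ≤ t - u := (sub_pos.2 hu.2).le
    have e1 : f u = T (t - u) (S (u - s) y) := by
      simp only [f, y]
      rw [max_eq_left hu0, max_eq_left htu, ← cS.apply_add hus hs.1, sub_add_cancel]
    have e2 : f s = T (t - u) (T (u - s) y) := by
      simp only [f, y]
      rw [max_eq_left hs.1, max_eq_left (by linarith : 0 ≤ t - s), ← cT.apply_add htu hus,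
        sub_add_sub_cancel]
    rw [slope_def_module, e1, e2, ← ofReal_inv_smul (𝕜 := 𝕜), ← map_sub, ← map_smul]
    refine ((T (t - u)).le_opNorm _).trans ?_
    simp only [Function.comp, ← smul_sub, sub_sub_sub_cancel_right]
    gcongr
    exact hK _ ⟨htu, by linarith⟩
  simp only [f, sub_self, max_self, sub_zero, max_eq_left ht, cT.apply_zero, cS.apply_zero] at key
  exact key.symm

end Generates

namespace IsResolvent
variable {A : X →ₗ.[𝕜] X} {T : ℝ → X →L[𝕜] X} {lam : 𝕜} {R : X →L[𝕜] X}

theorem mem_graph (hR : IsResolvent A lam R) (z : X) : (R z, lam • R z - z) ∈ A.graph := by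
  obtain ⟨h, e⟩ := hR.1 z
  have : lam • R z - z = A ⟨R z, h⟩ := by
    nth_rw 2 [← e]; abel
  rw [this]
  exact A.mem_graph ⟨R z, h⟩

theorem apply_of_mem_graph (hR : IsResolvent A lam R) {x y : X} (h : (x, y) ∈ A.graph) :
    R (lam • x - y) = x := by
  obtain ⟨z, rfl, rfl⟩ := (LinearPMap.mem_graph_iff _).1 h
  exact hR.2 z

theorem mem_graph_iff (hR : IsResolvent A lam R) {x y : X} :
    (x, y) ∈ A.graph ↔ R (lam • x - y) = x := by
  refine ⟨hR.apply_of_mem_graph, fun h => ?_⟩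
  have := hR.mem_graph (lam • x - y)
  rw [h] at this
  simpa using this

theorem injective (hR : IsResolvent A lam R) : Function.Injective R := by
  refine (injective_iff_map_eq_zero R).2 fun z hz => ?_
  have h := hR.mem_graph z
  rw [hz] at h
  simpa using LinearPMap.graph_fst_eq_zero_snd A h rfl

theorem denseRange [CompleteSpace X] (hR : IsResolvent A lam R) (hA : Generates A T) :
    DenseRange R :=
  hA.dense_domain.mono fun x hx => ⟨_, hR.2 ⟨x, hx⟩⟩

theorem apply_comm (hR : IsResolvent A lam R) (hA : Generates A T) {t : ℝ} (ht : 0 ≤ t) (x : X) :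
    R (T t x) = T t (R x) := by
  have h := hR.apply_of_mem_graph (hA.apply_mem_graph (hR.mem_graph x) ht)
  simpa using h

/-- Exhibits the integral of an orbit as an element of the range of `R`; applied to the perturbed
generator, this places the input integral in `X`. -/
theorem integral_apply [CompleteSpace X] [NormedSpace ℝ X] [IsScalarTower ℝ 𝕜 X]
    (hR : IsResolvent A lam R) (hA : Generates A T) {t : ℝ} (ht : 0 ≤ t) (z : X) :
    ∫ s in (0 : ℝ)..t, T s z = R (lam • (∫ s in (0 : ℝ)..t, T s z) - (T t z - z)) :=
  (hR.apply_of_mem_graph (hA.integral_mem_graph ht z)).symm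

end IsResolvent

/-! ### The extrapolation space as an isometric copy of `X` -/

theorem isResolvent_opResolvent {A : X →ₗ.[𝕜] X} {lam : 𝕜} (h : lam ∈ opResolventSet A) :
    IsResolvent A lam (opResolvent A lam) := by
  have h' : ∃ R, IsResolvent A lam R := h
  rw [opResolvent, dif_pos h']
  exact h'.choose_spec

section Extrap
variable (A : X →ₗ.[𝕜] X) (lam : 𝕜)

/-- The resolvent as an isometry from the extrapolation space into `X`. -/
def extrapResolvent [CompleteSpace X] : Extrap A lam →L[𝕜] X :=
  ContinuousLinearMap.extend
    ((preResolvent A lam).mkContinuous 1 fun x => (one_mul ‖x‖).symm.le)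
    (UniformSpace.Completion.toComplL (𝕜 := 𝕜) (E := PreExtrap A lam))

theorem extrapResolvent_incl [CompleteSpace X] (x : X) :
    extrapResolvent A lam (incl A lam x) = opResolvent A lam x :=
  ContinuousLinearMap.extend_eq (e := UniformSpace.Completion.toComplL (𝕜 := 𝕜)
      (E := PreExtrap A lam)) _
    UniformSpace.Completion.denseRange_coe
    (UniformSpace.Completion.isUniformInducing_coe _) (toPre A lam x)

theorem norm_extrapResolvent [CompleteSpace X] (e : Extrap A lam) :
    ‖extrapResolvent A lam e‖ = ‖e‖ := by
  refine congrFun ((denseRange_incl A lam).equalizer (by fun_prop) (by fun_prop)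
    (funext fun x => ?_) : (fun e => ‖extrapResolvent A lam e‖) = fun e => ‖e‖) e
  simp only [Function.comp]
  rw [extrapResolvent_incl, norm_incl]

end Extrap

variable {A : X →ₗ.[𝕜] X} {T : ℝ → X →L[𝕜] X} {lam : 𝕜}

theorem incl_injective [CompleteSpace X] (hlam : lam ∈ opResolventSet A) :
    Function.Injective (incl A lam) := fun x y h =>
  (isResolvent_opResolvent hlam).injective (by
    rw [← extrapResolvent_incl, h, extrapResolvent_incl])

/-- An isometry on a complete space has closed range, and this range contains the range of the
resolvent, which is dense because it contains `dom A`. -/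
theorem surjective_extrapResolvent [CompleteSpace X] (hA : Generates A T)
    (hlam : lam ∈ opResolventSet A) : Function.Surjective (extrapResolvent A lam) := by
  have hiso : Isometry (extrapResolvent A lam) :=
    AddMonoidHomClass.isometry_of_norm _ (norm_extrapResolvent A lam)
  have hcl : IsClosed (range (extrapResolvent A lam)) := hiso.isClosedEmbedding.isClosed_range
  rw [← range_eq_univ, ← hcl.closure_eq]
  refine Dense.closure_eq (Dense.mono ?_ ((isResolvent_opResolvent hlam).denseRange hA))
  rintro _ ⟨x, rfl⟩
  exact ⟨incl A lam x, extrapResolvent_incl A lam x⟩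

/-- The resolvent `(lam I - A₋₁)⁻¹` as an isometric isomorphism of `X₋₁` onto `X`. -/
def extrapEquiv [CompleteSpace X] (hA : Generates A T) (hlam : lam ∈ opResolventSet A) :
    Extrap A lam ≃ₗᵢ[𝕜] X :=
  LinearIsometryEquiv.ofSurjective
    ⟨(extrapResolvent A lam).toLinearMap, norm_extrapResolvent A lam⟩
    (surjective_extrapResolvent hA hlam)

section
variable [CompleteSpace X] (hA : Generates A T) (hlam : lam ∈ opResolventSet A)

theorem extrapEquiv_incl (x : X) : extrapEquiv hA hlam (incl A lam x) = opResolvent A lam x :=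
  extrapResolvent_incl A lam x

theorem extrapEquiv_symm_opResolvent (x : X) :
    (extrapEquiv hA hlam).symm (opResolvent A lam x) = incl A lam x := by
  rw [← extrapEquiv_incl hA hlam, LinearIsometryEquiv.symm_apply_apply]

theorem incl_eq_iff {x : X} {e : Extrap A lam} :
    incl A lam x = e ↔ opResolvent A lam x = extrapEquiv hA hlam e := by
  rw [← extrapEquiv_incl hA hlam, (extrapEquiv hA hlam).injective.eq_iff]

/-- The intertwining relation makes the conjugate of `S'` a continuous extension of `S`, so
`extendOp` does not take its default value. `S'` may differ from `S`: the perturbed semigroup need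
not commute with the resolvent of `A`. -/
theorem extrapEquiv_extendOp {S S' : X →L[𝕜] X}
    (h : ∀ x, S' (opResolvent A lam x) = opResolvent A lam (S x)) (e : Extrap A lam) :
    extrapEquiv hA hlam (extendOp A lam S e) = S' (extrapEquiv hA hlam e) := by
  have hex : ∃ L : Extrap A lam →L[𝕜] Extrap A lam, ∀ x, L (incl A lam x) = incl A lam (S x) := by
    refine ⟨((extrapEquiv hA hlam).symm.toContinuousLinearEquiv.toContinuousLinearMap.comp
      S').comp (extrapEquiv hA hlam).toContinuousLinearEquiv.toContinuousLinearMap, fun x => ?_⟩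
    change (extrapEquiv hA hlam).symm (S' (extrapEquiv hA hlam (incl A lam x))) = _
    rw [extrapEquiv_incl, h, extrapEquiv_symm_opResolvent]
  have hspec : ∀ x, extendOp A lam S (incl A lam x) = incl A lam (S x) := by
    rw [extendOp, dif_pos hex]
    exact hex.choose_spec
  refine congrFun ((denseRange_incl A lam).equalizer
    ((extrapEquiv hA hlam).continuous.comp (extendOp A lam S).continuous)
    (S'.continuous.comp (extrapEquiv hA hlam).continuous) (funext fun x => ?_)) e
  simp only [Function.comp]
  rw [hspec, extrapEquiv_incl, extrapEquiv_incl, h]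

theorem extrapEquiv_extendOp_semigroup {t : ℝ} (ht : 0 ≤ t) (e : Extrap A lam) :
    extrapEquiv hA hlam (extendOp A lam (T t) e) = T t (extrapEquiv hA hlam e) :=
  extrapEquiv_extendOp hA hlam
    (fun x => ((isResolvent_opResolvent hlam).apply_comm hA ht x).symm) e

/-- On `dom A` one has `R A x = λ R x - x`, whose right side is bounded on `X`; this gives both
existence of the extension and its formula, by density. -/
theorem extrapEquiv_extendGen (x : X) :
    extrapEquiv hA hlam (extendGen A lam x) = lam • opResolvent A lam x - x := by
  have hR := isResolvent_opResolvent hlam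
  have hAx : ∀ x : A.domain, opResolvent A lam (A x) = lam • opResolvent A lam x - x := by
    intro x
    have h := hR.2 x
    rw [map_sub, map_smul] at h
    rw [eq_sub_iff_add_eq, ← eq_sub_iff_add_eq']
    exact h.symm
  have hex : ∃ L : X →L[𝕜] Extrap A lam, ∀ x : A.domain, L x = incl A lam (A x) := by
    refine ⟨lam • incl A lam -
      (extrapEquiv hA hlam).symm.toContinuousLinearEquiv.toContinuousLinearMap, fun x => ?_⟩
    symm
    rw [incl_eq_iff hA hlam, hAx]
    change _ = extrapEquiv hA hlam (lam • incl A lam x - (extrapEquiv hA hlam).symm x)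
    rw [map_sub, map_smul, extrapEquiv_incl, LinearIsometryEquiv.apply_symm_apply]
  have hspec : ∀ x : A.domain, extendGen A lam x = incl A lam (A x) := by
    rw [extendGen, dif_pos hex]
    exact hex.choose_spec
  refine congrFun (hA.dense_domain.denseRange_val.equalizer
    (g := fun x => extrapEquiv hA hlam (extendGen A lam x))
    (h := fun x => lam • opResolvent A lam x - x)
    ((extrapEquiv hA hlam).continuous.comp (extendGen A lam).continuous)
    (by fun_prop) (funext fun x => ?_)) x
  simp only [Function.comp]
  rw [hspec, extrapEquiv_incl, hAx]

theorem mem_perturbedGen_graph_iff (D : X →L[𝕜] Extrap A lam) {x y : X} :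
    (x, y) ∈ (perturbedGen A lam D).graph ↔
      lam • opResolvent A lam x - x + extrapEquiv hA hlam (D x) = opResolvent A lam y := by
  rw [perturbedGen, Submodule.toLinearPMap_graph_eq]
  · change (extendGen A lam + D) x = incl A lam y ↔ _
    rw [eq_comm, incl_eq_iff hA hlam, add_apply, map_add,
      extrapEquiv_extendGen, eq_comm]
  · rintro ⟨x, y⟩ h hx
    change (extendGen A lam + D) x = incl A lam y at h
    change x = 0 at hx
    change y = 0
    rw [hx, map_zero] at h
    exact (injective_iff_map_eq_zero' _).1 (incl_injective hlam) y |>.1 h.symm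

/-- An isomorphism commutes with the Bochner integral even for non-integrable `f`, so no
measurability in `X₋₁` has to be checked. -/
theorem extrapEquiv_intervalIntegral [NormedSpace ℝ X] [IsScalarTower ℝ 𝕜 X]
    (f : ℝ → Extrap A lam) (a b : ℝ) :
    extrapEquiv hA hlam (∫ s in a..b, f s) = ∫ s in a..b, extrapEquiv hA hlam (f s) := by
  have key := fun s : Set ℝ => ContinuousLinearEquiv.integral_comp_comm
    (μ := MeasureTheory.volume.restrict s)
    (extrapEquiv hA hlam).toContinuousLinearEquiv f
  rw [intervalIntegral, intervalIntegral, map_sub]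
  exact congrArg₂ (· - ·) (key _).symm (key _).symm

theorem extrapEquiv_volterra [NormedSpace ℝ X] [IsScalarTower ℝ 𝕜 X] {t₀ : ℝ}
    (D : X →L[𝕜] Extrap A lam) (Q : StrongCont 𝕜 X t₀) {t : ℝ} (ht : 0 ≤ t) (x : X) :
    extrapEquiv hA hlam (volterra A lam T D Q t x) =
      ∫ s in (0 : ℝ)..t, T (t - s) (extrapEquiv hA hlam (D (Q.toReal s x))) := by
  rw [volterra, extrapEquiv_intervalIntegral]
  refine intervalIntegral.integral_congr fun s hs => ?_
  rw [uIcc_of_le ht] at hs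
  exact extrapEquiv_extendOp_semigroup hA hlam (sub_nonneg.2 hs.2) _

end

/-! ### Convolutions with a semigroup -/

/-- Fubini for the indicator of the triangle `r ≤ s` in the square `(0, t]²`. -/
theorem intervalIntegral_triangle_swap {E : Type*} [NormedAddCommGroup E] [NormedSpace ℝ E]
    {k : ℝ → ℝ → E} (hk : Continuous (Function.uncurry k)) {t : ℝ} (ht : 0 ≤ t) :
    ∫ s in (0 : ℝ)..t, ∫ r in (0 : ℝ)..s, k s r = ∫ r in (0 : ℝ)..t, ∫ s in r..t, k s r := by
  have hint : MeasureTheory.Integrable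
      (Function.uncurry fun s r => {p : ℝ × ℝ | p.2 ≤ p.1}.indicator (Function.uncurry k) (s, r))
      ((MeasureTheory.volume.restrict (Ioc 0 t)).prod
        (MeasureTheory.volume.restrict (Ioc 0 t))) := by
    have h1 : MeasureTheory.IntegrableOn (Function.uncurry k) (Icc 0 t ×ˢ Icc 0 t)
        (MeasureTheory.volume.prod MeasureTheory.volume) :=
      hk.continuousOn.integrableOn_compact (isCompact_Icc.prod isCompact_Icc)
    rw [MeasureTheory.Measure.prod_restrict]
    exact (h1.mono_set (prod_mono Ioc_subset_Icc_self Ioc_subset_Icc_self)).indicator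
      (measurableSet_le measurable_snd measurable_fst)
  have hswap := MeasureTheory.integral_integral_swap hint
  rw [intervalIntegral.integral_of_le ht, intervalIntegral.integral_of_le ht]
  refine Eq.trans ?_ (hswap.trans ?_)
  · refine MeasureTheory.setIntegral_congr_fun measurableSet_Ioc fun s hs => ?_
    have e : (fun r => {p : ℝ × ℝ | p.2 ≤ p.1}.indicator (Function.uncurry k) (s, r)) =
        (Iic s).indicator (k s) := by
      ext r
      simp [indicator, Function.uncurry]
    simp only [e]
    rw [MeasureTheory.setIntegral_indicator measurableSet_Iic, Ioc_inter_Iic, min_eq_right hs.2,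
      intervalIntegral.integral_of_le hs.1.le]
  · refine MeasureTheory.setIntegral_congr_fun measurableSet_Ioc fun r hr => ?_
    have e : (fun s => {p : ℝ × ℝ | p.2 ≤ p.1}.indicator (Function.uncurry k) (s, r)) =
        (Ici r).indicator (fun s => k s r) := by
      ext s
      simp [indicator, Function.uncurry]
    simp only [e]
    have hset : Ioc 0 t ∩ Ici r = Icc r t := by
      ext s
      simp only [mem_inter_iff, mem_Ioc, mem_Ici, mem_Icc]
      exact ⟨fun h => ⟨h.2, h.1.2⟩, fun h => ⟨⟨hr.1.trans_le h.1, h.2⟩, h.1⟩⟩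
    rw [MeasureTheory.setIntegral_indicator measurableSet_Ici, hset,
      intervalIntegral.integral_of_le hr.2, MeasureTheory.integral_Icc_eq_integral_Ioc]

theorem convolution_integrable [CompleteSpace X] {T : ℝ → X →L[𝕜] X} {g : ℝ → X}
    (hT : IsC0Semigroup T) (hg : Continuous g) {a b t : ℝ}
    (ha : a ≤ t) (hb : b ≤ t) :
    IntervalIntegrable (fun s => T (t - s) (g s)) MeasureTheory.volume a b := by
  have h : Continuous fun s => T (max (t - s) 0) (g s) :=
    hT.continuous_max_apply (by fun_prop) hg
  refine ContinuousOn.intervalIntegrable (h.continuousOn.congr fun s hs => ?_)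
  have h0 : max (t - s) 0 = t - s := max_eq_left (sub_nonneg.2 (hs.2.trans (max_le ha hb)))
  simp only [h0]

section Convolution
variable [NormedSpace ℝ X] {T : ℝ → X →L[𝕜] X} {g : ℝ → X}

theorem convolution_max {t : ℝ} (ht : 0 ≤ t) :
    ∫ s in (0 : ℝ)..t, T (max (t - s) 0) (g s) = ∫ s in (0 : ℝ)..t, T (t - s) (g s) :=
  intervalIntegral.integral_congr fun s hs => by
    rw [uIcc_of_le ht] at hs
    have h0 : max (t - s) 0 = t - s := max_eq_left (sub_nonneg.2 hs.2)
    rw [h0]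

theorem convolution_add [CompleteSpace X] (hT : IsC0Semigroup T) (hg : Continuous g) {s t : ℝ} (hs : 0 ≤ s)
    (ht : 0 ≤ t) :
    ∫ r in (0 : ℝ)..t + s, T (t + s - r) (g r) =
      T t (∫ r in (0 : ℝ)..s, T (s - r) (g r)) + ∫ r in (0 : ℝ)..t, T (t - r) (g (r + s)) := by
  rw [← intervalIntegral.integral_add_adjacent_intervals (b := s)
    (convolution_integrable hT hg (by linarith) (by linarith))
    (convolution_integrable hT hg (by linarith) (by linarith))]
  congr 1
  · rw [← ContinuousLinearMap.intervalIntegral_comp_comm _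
      (convolution_integrable hT hg hs le_rfl)]
    refine intervalIntegral.integral_congr fun r hr => ?_
    rw [uIcc_of_le hs] at hr
    rw [← hT.apply_add ht (sub_nonneg.2 hr.2), add_sub_assoc]
  · have := intervalIntegral.integral_comp_add_right (a := 0) (b := t)
      (fun r => T (t + s - r) (g r)) s
    rw [zero_add] at this
    rw [← this]
    simp only [add_sub_add_right_eq_sub]

theorem convolution_const {t : ℝ} (x : X) :
    ∫ s in (0 : ℝ)..t, T (t - s) x = ∫ s in (0 : ℝ)..t, T s x := by
  rw [intervalIntegral.integral_comp_sub_left (fun s => T s x) t, sub_self, sub_zero]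

/-- Associativity of convolution, `T * (1 * g) = 1 * (T * g)`. -/
theorem convolution_integral [CompleteSpace X] (hT : IsC0Semigroup T) (hg : Continuous g) {t : ℝ} (ht : 0 ≤ t) :
    ∫ s in (0 : ℝ)..t, T (t - s) (∫ r in (0 : ℝ)..s, g r) =
      ∫ s in (0 : ℝ)..t, ∫ r in (0 : ℝ)..s, T (s - r) (g r) := by
  have c1 : Continuous (Function.uncurry fun s r => T (max (t - s) 0) (g r)) :=
    hT.continuous_max_apply (u := fun p : ℝ × ℝ => t - p.1) (by fun_prop) (by fun_prop)
  have c2 : Continuous (Function.uncurry fun s r => T (max (s - r) 0) (g r)) :=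
    hT.continuous_max_apply (u := fun p : ℝ × ℝ => p.1 - p.2) (by fun_prop) (by fun_prop)
  have e1 : ∫ s in (0 : ℝ)..t, T (t - s) (∫ r in (0 : ℝ)..s, g r) =
      ∫ s in (0 : ℝ)..t, ∫ r in (0 : ℝ)..s, T (max (t - s) 0) (g r) := by
    rw [← convolution_max ht]
    refine intervalIntegral.integral_congr fun s _ => ?_
    exact (ContinuousLinearMap.intervalIntegral_comp_comm _ (hg.intervalIntegrable _ _)).symm
  have e2 : ∫ s in (0 : ℝ)..t, ∫ r in (0 : ℝ)..s, T (s - r) (g r) =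
      ∫ s in (0 : ℝ)..t, ∫ r in (0 : ℝ)..s, T (max (s - r) 0) (g r) := by
    refine intervalIntegral.integral_congr fun s hs => ?_
    rw [uIcc_of_le ht] at hs
    exact (convolution_max hs.1).symm
  rw [e1, e2, intervalIntegral_triangle_swap c1 ht, intervalIntegral_triangle_swap c2 ht]
  refine intervalIntegral.integral_congr fun r _ => ?_
  -- The reflection `s ↦ t + r - s` of `[r, t]` exchanges `t - s` and `s - r`.
  have := intervalIntegral.integral_comp_sub_left (a := r) (b := t)
    (fun s => T (max (s - r) 0) (g r)) (t + r)
  simp only [add_sub_cancel_right, add_sub_cancel_left] at this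
  rw [← this]
  refine intervalIntegral.integral_congr fun s _ => ?_
  have h0 : t + r - s - r = t - s := by ring
  simp only [h0]

theorem tendsto_inv_smul_convolution [CompleteSpace X] (hT : IsC0Semigroup T) (hg : Continuous g) :
    Tendsto (fun h : ℝ => h⁻¹ • ∫ s in (0 : ℝ)..h, T (h - s) (g s)) (𝓝[>] 0) (𝓝 (g 0)) := by
  have c : Continuous fun p : ℝ × ℝ => T (max (p.1 - p.2) 0) (g p.2) :=
    hT.continuous_max_apply (by fun_prop) (by fun_prop)
  rw [Metric.tendsto_nhds]
  intro ε hε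
  have h1 := Metric.continuous_iff.1 c (0, 0) (ε / 2) (half_pos hε)
  obtain ⟨δ, hδ, h1⟩ := h1
  simp only [sub_self, max_self, hT.apply_zero] at h1
  filter_upwards [Ioo_mem_nhdsGT hδ] with h hh
  have hne : h ≠ 0 := hh.1.ne'
  have e : (h⁻¹ • ∫ s in (0 : ℝ)..h, T (h - s) (g s)) - g 0 =
      h⁻¹ • ∫ s in (0 : ℝ)..h, (T (h - s) (g s) - g 0) := by
    rw [intervalIntegral.integral_sub (convolution_integrable hT hg hh.1.le le_rfl)
      (intervalIntegrable_const), smul_sub, intervalIntegral.integral_const, sub_zero,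
      inv_smul_smul₀ hne]
  rw [dist_eq_norm, e, norm_smul, norm_inv, Real.norm_of_nonneg hh.1.le]
  have h2 : ‖∫ s in (0 : ℝ)..h, (T (h - s) (g s) - g 0)‖ ≤ ε / 2 * |h - 0| := by
    refine intervalIntegral.norm_integral_le_of_norm_le_const fun s hs => ?_
    rw [uIoc_of_le hh.1.le] at hs
    have h3 := h1 (h, s) (by
      rw [Prod.dist_eq, max_lt_iff, Real.dist_eq, Real.dist_eq, sub_zero, sub_zero,
        abs_of_pos hh.1, abs_of_pos hs.1]
      exact ⟨hh.2, hs.2.trans_lt hh.2⟩)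
    have h0 : max (h - s) 0 = h - s := max_eq_left (sub_nonneg.2 hs.2)
    rw [dist_eq_norm] at h3
    simp only [h0] at h3
    exact h3.le
  rw [sub_zero, abs_of_pos hh.1] at h2
  calc h⁻¹ * _ ≤ h⁻¹ * (ε / 2 * h) := by
        gcongr
        exact inv_nonneg.2 hh.1.le
    _ = ε / 2 := by field_simp
    _ < ε := half_lt_self hε

end Convolution

/-! ### The space of strongly continuous functions -/

namespace StrongCont
variable {t₀ : ℝ}

theorem norm_apply_le [CompleteSpace X] (Q : StrongCont 𝕜 X t₀) (t : Icc (0 : ℝ) t₀) : ‖Q t‖ ≤ ‖Q‖ :=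
  le_ciSup Q.bddAbove t

theorem norm_le (Q : StrongCont 𝕜 X t₀) {C : ℝ} (hC : 0 ≤ C) (h : ∀ t, ‖Q t‖ ≤ C) : ‖Q‖ ≤ C :=
  Real.iSup_le h hC

/-- The restriction to `[0, t₀]` of a family of operators. -/
def ofContinuousOn (S : ℝ → X →L[𝕜] X) (hS : ∀ x, ContinuousOn (fun t => S t x) (Icc 0 t₀)) :
    StrongCont 𝕜 X t₀ :=
  ⟨fun t => S t, fun x => (hS x).domRestrict⟩

theorem ofContinuousOn_apply (S : ℝ → X →L[𝕜] X)
    (hS : ∀ x, ContinuousOn (fun t => S t x) (Icc 0 t₀)) (t : Icc (0 : ℝ) t₀) :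
    ofContinuousOn S hS t = S t := rfl

theorem toReal_of_mem (Q : StrongCont 𝕜 X t₀) {s : ℝ} (hs : s ∈ Icc 0 t₀) :
    Q.toReal s = Q ⟨s, hs⟩ := by
  rw [toReal, dif_pos hs]

/-- Operator-norm uniform limits preserve strong continuity. Completeness is what lets the Neumann
series for `(1 - V)⁻¹` converge. -/
instance [CompleteSpace X] : CompleteSpace (StrongCont 𝕜 X t₀) := by
  refine Metric.complete_of_cauchySeq_tendsto fun Q hQ => ?_
  have hunif : UniformCauchySeqOn (fun n t => Q n t) atTop univ := by
    rw [Metric.uniformCauchySeqOn_iff]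
    intro ε hε
    obtain ⟨N, hN⟩ := Metric.cauchySeq_iff.1 hQ ε hε
    refine ⟨N, fun m hm n hn t _ => ?_⟩
    rw [dist_eq_norm]
    refine (norm_apply_le (Q m - Q n) t).trans_lt ?_
    rw [← dist_eq_norm]
    exact hN m hm n hn
  choose P hP using fun t => cauchySeq_tendsto_of_complete (hunif.cauchySeq (mem_univ t))
  have hlim : TendstoUniformlyOn (fun n t => Q n t) P atTop univ :=
    hunif.tendstoUniformlyOn_of_tendsto fun t _ => hP t
  rw [tendstoUniformlyOn_univ] at hlim
  have hcont : ∀ x, Continuous fun t => P t x := by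
    intro x
    have hx : TendstoUniformly (fun n t => Q n t x) (fun t => P t x) atTop := by
      rw [Metric.tendstoUniformly_iff] at hlim ⊢
      intro ε hε
      filter_upwards [hlim (ε / (‖x‖ + 1)) (by positivity)] with n hn t
      rw [dist_eq_norm, ← sub_apply]
      calc ‖(P t - Q n t) x‖ ≤ ‖P t - Q n t‖ * ‖x‖ := ContinuousLinearMap.le_opNorm _ _
        _ ≤ ‖P t - Q n t‖ * (‖x‖ + 1) := by gcongr; linarith
        _ < ε / (‖x‖ + 1) * (‖x‖ + 1) := by
            gcongr
            rw [← dist_eq_norm]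
            exact hn t
        _ = ε := by field_simp
    exact hx.continuous (Eventually.frequently (Eventually.of_forall fun n => (Q n).2 x))
  let P' : StrongCont 𝕜 X t₀ := ⟨P, hcont⟩
  refine ⟨P', ?_⟩
  rw [Metric.tendsto_nhds]
  intro ε hε
  rw [Metric.tendstoUniformly_iff] at hlim
  filter_upwards [hlim (ε / 2) (half_pos hε)] with n hn
  rw [dist_eq_norm]
  refine (norm_le _ (half_pos hε).le fun t => ?_).trans_lt (half_lt_self hε)
  have := (hn t).le
  rw [dist_comm, dist_eq_norm] at this
  exact this

end StrongCont

/-! ### Desch–Schappacher perturbation theorem, in resolvent form -/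

/-- `V` is the abstract Volterra operator `(V Q)(t) x = ∫₀ᵗ T₋₁(t - s) Ψ Q(s) x ds`, where
`K = (lam I - A₋₁)⁻¹ Ψ` and `R = (lam I - A)⁻¹`. -/
structure IsVolterra [CompleteSpace X] [NormedSpace ℝ X] (T : ℝ → X →L[𝕜] X) (R K : X →L[𝕜] X)
    {t₀ : ℝ} (V : StrongCont 𝕜 X t₀ →L[𝕜] StrongCont 𝕜 X t₀) : Prop where
  isC0Semigroup : IsC0Semigroup T
  injective : Function.Injective R
  comm : ∀ t, 0 ≤ t → ∀ x, R (T t x) = T t (R x)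
  apply : ∀ (Q : StrongCont 𝕜 X t₀) (t : Icc (0 : ℝ) t₀) (x : X),
    R (V Q t x) = ∫ s in (0 : ℝ)..t, T (t - s) (K (Q.toReal s x))
  norm_lt_one : ‖V‖ < 1

namespace IsVolterra
variable [CompleteSpace X] [NormedSpace ℝ X] {T : ℝ → X →L[𝕜] X} {R K : X →L[𝕜] X} {t₀ : ℝ}
  {V : StrongCont 𝕜 X t₀ →L[𝕜] StrongCont 𝕜 X t₀}

/-- The bound on the Volterra operator, applied to vector-valued functions. -/
theorem norm_le_of_eq_convolution (hV : IsVolterra T R K V) {w : ℝ → X} {M : ℝ} (hM : 0 ≤ M)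
    (hw : ContinuousOn w (Icc 0 t₀)) (hwM : ∀ s ∈ Icc 0 t₀, ‖w s‖ ≤ M) {t : ℝ}
    (ht : t ∈ Icc 0 t₀) {v : X} (hv : R v = ∫ s in (0 : ℝ)..t, T (t - s) (K (w s))) :
    ‖v‖ ≤ ‖V‖ * M := by
  by_cases h0 : ‖v‖ = 0
  · rw [h0]; positivity
  -- The rank-one family `Q(s) = φ ⊗ w(s)` with `‖φ‖ = 1` and `φ(v) = ‖v‖` turns the vector equation
  -- into an operator one: `(V Q)(t) v = ‖v‖ v`.
  obtain ⟨φ, hφ, hφv⟩ := exists_dual_vector 𝕜 v h0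
  let Q : StrongCont 𝕜 X t₀ := StrongCont.ofContinuousOn (fun s => φ.smulRight (w s))
    fun x => by
      simp only [ContinuousLinearMap.smulRight_apply]
      exact hw.const_smul (φ x)
  have hQ : ‖Q‖ ≤ M := Q.norm_le hM fun s => by
    rw [StrongCont.ofContinuousOn_apply, ContinuousLinearMap.norm_smulRight_apply, hφ, one_mul]
    exact hwM s s.2
  have e : V Q ⟨t, ht⟩ v = (‖v‖ : 𝕜) • v := by
    apply hV.injective
    rw [hV.apply, map_smul, hv, ← intervalIntegral.integral_smul]
    refine intervalIntegral.integral_congr fun s hs => ?_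
    rw [uIcc_of_le ht.1] at hs
    have hs' : s ∈ Icc 0 t₀ := ⟨hs.1, hs.2.trans ht.2⟩
    simp only
    rw [Q.toReal_of_mem hs', StrongCont.ofContinuousOn_apply,
      ContinuousLinearMap.smulRight_apply, hφv, map_smul, map_smul]
  have h1 : ‖v‖ * ‖v‖ ≤ ‖V‖ * M * ‖v‖ := by
    calc ‖v‖ * ‖v‖ = ‖V Q ⟨t, ht⟩ v‖ := by rw [e, norm_smul, RCLike.norm_ofReal, abs_norm]
      _ ≤ ‖V Q ⟨t, ht⟩‖ * ‖v‖ := ContinuousLinearMap.le_opNorm _ _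
      _ ≤ ‖V‖ * M * ‖v‖ := by
        gcongr
        exact ((V Q).norm_apply_le _).trans ((V.le_opNorm Q).trans (by gcongr))
  exact le_of_mul_le_mul_right h1 ((norm_nonneg v).lt_of_ne' h0)

/-- At a maximum point of `‖w‖` the Volterra bound gives `‖w‖ ≤ ‖V‖ ‖w‖` with `‖V‖ < 1`. To apply
that bound, `w` is extended constantly from `[0, b]` to `[0, t₀]`. -/
theorem eq_zero_of_eq_convolution (hV : IsVolterra T R K V) {w : ℝ → X} {b : ℝ} (hb : b ≤ t₀)
    (hw : ContinuousOn w (Icc 0 b))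
    (h : ∀ t ∈ Icc 0 b, R (w t) = ∫ s in (0 : ℝ)..t, T (t - s) (K (w s)))
    {t : ℝ} (ht : t ∈ Icc 0 b) : w t = 0 := by
  obtain ⟨m, hm, hmax⟩ := isCompact_Icc.exists_isMaxOn ⟨t, ht⟩ hw.norm
  have hmin : ∀ s ∈ Icc 0 t₀, min s b ∈ Icc 0 b := fun s hs =>
    ⟨le_min hs.1 (ht.1.trans ht.2), min_le_right _ _⟩
  have h1 : ‖w m‖ ≤ ‖V‖ * ‖w m‖ := by
    refine hV.norm_le_of_eq_convolution (w := fun s => w (min s b)) (norm_nonneg _)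
      (hw.comp (by fun_prop) hmin) (fun s hs => hmax (hmin s hs)) (t := m)
      ⟨hm.1, hm.2.trans hb⟩ ?_
    rw [h m hm]
    refine intervalIntegral.integral_congr fun s hs => ?_
    rw [uIcc_of_le hm.1] at hs
    have h0 : min s b = s := min_eq_left (hs.2.trans hm.2)
    simp only [h0]
  have h2 : ‖w m‖ = 0 := by
    nlinarith [hV.norm_lt_one, norm_nonneg (w m)]
  exact norm_le_zero_iff.1 ((hmax ht).trans h2.le)

/-- The solution of the operator equation `S = T + V S`, together with its distance to `T`. -/
theorem exists_fixedPoint (hV : IsVolterra T R K V) (ht₀ : 0 ≤ t₀) :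
    ∃ S : ℝ → X →L[𝕜] X, (∀ x, Continuous fun t => S t x) ∧
      (∀ t ∈ Icc 0 t₀, ∀ x,
        R (S t x) = R (T t x) + ∫ s in (0 : ℝ)..t, T (t - s) (K (S s x))) ∧
      ∀ C, (∀ t ∈ Icc 0 t₀, ‖T t‖ ≤ C) → ∀ t ∈ Icc 0 t₀, ‖S t - T t‖ ≤ ‖V‖ * (C / (1 - ‖V‖)) := by
  let P : StrongCont 𝕜 X t₀ := StrongCont.ofContinuousOn T fun x =>
    (hV.isC0Semigroup.continuousOn x).mono Icc_subset_Ici_self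
  -- The solution is `Q = (1 - V)⁻¹ T`, by the Neumann series.
  let u := Units.oneSub V hV.norm_lt_one
  let Q : StrongCont 𝕜 X t₀ := (u⁻¹ : (StrongCont 𝕜 X t₀ →L[𝕜] StrongCont 𝕜 X t₀)ˣ).1 P
  have hQ : Q - V Q = P := by
    have : (u.1 * (u⁻¹).1) P = P := by rw [Units.mul_inv]; rfl
    exact this
  have hQ' : Q - P = V Q := by rw [← hQ]; abel
  have hproj : ∀ t (ht : t ∈ Icc 0 t₀), Q (projIcc 0 t₀ ht₀ t) = Q ⟨t, ht⟩ := fun t ht => by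
    rw [projIcc_of_mem ht₀ ht]
  refine ⟨fun t => Q (projIcc 0 t₀ ht₀ t), fun x => (Q.2 x).comp continuous_projIcc, ?_, ?_⟩
  · intro t ht x
    have h1 : Q ⟨t, ht⟩ - T t = V Q ⟨t, ht⟩ := by rw [← hQ']; rfl
    simp only [hproj t ht]
    rw [← sub_eq_iff_eq_add', ← map_sub, ← sub_apply, h1, hV.apply]
    refine intervalIntegral.integral_congr fun s hs => ?_
    rw [uIcc_of_le ht.1] at hs
    have hs' : s ∈ Icc 0 t₀ := ⟨hs.1, hs.2.trans ht.2⟩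
    simp only [hproj s hs', Q.toReal_of_mem hs']
  · intro C hC t ht
    have hC0 : 0 ≤ C := (norm_nonneg _).trans (hC t ht)
    have hPC : ‖P‖ ≤ C := P.norm_le hC0 fun s => hC s s.2
    have hlt := hV.norm_lt_one
    have hQC : ‖Q‖ ≤ C / (1 - ‖V‖) := by
      rw [le_div_iff₀ (by linarith)]
      have : ‖Q‖ ≤ ‖P‖ + ‖V‖ * ‖Q‖ := by
        calc ‖Q‖ = ‖P + V Q‖ := by rw [← hQ']; congr 1; abel
          _ ≤ ‖P‖ + ‖V Q‖ := norm_add_le _ _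
          _ ≤ _ := by gcongr; exact V.le_opNorm Q
      linarith
    have h1 : Q ⟨t, ht⟩ - T t = V Q ⟨t, ht⟩ := by rw [← hQ']; rfl
    simp only [hproj t ht, h1]
    calc ‖V Q ⟨t, ht⟩‖ ≤ ‖V Q‖ := (V Q).norm_apply_le _
      _ ≤ ‖V‖ * ‖Q‖ := V.le_opNorm Q
      _ ≤ _ := by gcongr

/-- For fixed `s`, the defect `t ↦ S(t + s)x - S(t)S(s)x` solves the homogeneous Volterra equation
on `[0, t₀ - s]`, hence vanishes. -/
theorem fixedPoint_add (hV : IsVolterra T R K V) {S : ℝ → X →L[𝕜] X}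
    (hSc : ∀ x, Continuous fun t => S t x)
    (hS : ∀ t ∈ Icc 0 t₀, ∀ x,
      R (S t x) = R (T t x) + ∫ s in (0 : ℝ)..t, T (t - s) (K (S s x)))
    {s t : ℝ} (hs : 0 ≤ s) (ht : 0 ≤ t) (hst : t + s ≤ t₀) : S (t + s) = S t * S s := by
  ext x
  change S (t + s) x = S t (S s x)
  have hT := hV.isC0Semigroup
  have hKS : ∀ x, Continuous fun r => K (S r x) := fun x => K.continuous.comp (hSc x)
  rw [← sub_eq_zero]
  refine hV.eq_zero_of_eq_convolution (w := fun t => S (t + s) x - S t (S s x))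
    (b := t₀ - s) (by linarith) ?_ (fun t ht => ?_) ⟨ht, by linarith⟩
  · exact (((hSc x).comp (by fun_prop)).sub (hSc (S s x))).continuousOn
  · have ht0 : t + s ∈ Icc 0 t₀ := ⟨by linarith [ht.1], by linarith [ht.2]⟩
    rw [map_sub, hS (t + s) ht0, hS t ⟨ht.1, by linarith [ht.2]⟩,
      convolution_add hT (hKS x) hs ht.1, hT.apply_add ht.1 hs, hV.comm t ht.1,
      hV.comm t ht.1 (S s x), hS s ⟨hs, by linarith⟩, map_add, ← add_assoc, add_sub_add_left_eq_sub]
    simp only [map_sub]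
    exact (intervalIntegral.integral_sub
      (convolution_integrable hT (g := fun r => K (S (r + s) x))
        ((hKS x).comp (by fun_prop : Continuous fun r : ℝ => r + s)) ht.1 le_rfl)
      (convolution_integrable hT (hKS _) ht.1 le_rfl)).symm

end IsVolterra

/-! ### Extension of local semigroups -/

section LocalSemigroup
variable {S : ℝ → X →L[𝕜] X} {t₀ : ℝ}

theorem localSemigroup_pow (h0 : S 0 = 1)
    (hadd : ∀ s t, 0 ≤ s → 0 ≤ t → t + s ≤ t₀ → S (t + s) = S t * S s) (n : ℕ) {u : ℝ}
    (hu : 0 ≤ u) (hnu : n * u ≤ t₀) : S (n * u) = S u ^ n := by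
  induction n with
  | zero => simpa using h0
  | succ n ih =>
    push_cast at hnu ⊢
    rw [add_mul, one_mul] at hnu ⊢
    rw [hadd u (n * u) hu (by positivity) hnu, ih (by linarith), pow_succ]

/-- Both sides equal the power for the common refinement into `m n` pieces. -/
theorem localSemigroup_pow_eq_pow (h0 : S 0 = 1)
    (hadd : ∀ s t, 0 ≤ s → 0 ≤ t → t + s ≤ t₀ → S (t + s) = S t * S s) {m n : ℕ} {t : ℝ}
    (ht : 0 ≤ t) (hm : 0 < m) (hn : 0 < n) (htm : t ≤ m * t₀) (htn : t ≤ n * t₀) :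
    S (t / m) ^ m = S (t / n) ^ n := by
  have key : ∀ m n : ℕ, 0 < m → 0 < n → t ≤ m * t₀ → S (t / m) ^ m = S (t / (m * n)) ^ (m * n) := by
    intro m n hm hn h
    have hm' : (0 : ℝ) < m := by exact_mod_cast hm
    have hn' : (0 : ℝ) < n := by exact_mod_cast hn
    have e : t / m = n * (t / (m * n)) := by field_simp
    have hle : t / m ≤ t₀ := by rw [div_le_iff₀ hm']; linarith
    rw [e] at hle
    rw [e, localSemigroup_pow h0 hadd n (by positivity) hle, ← pow_mul, mul_comm n m]
  rw [key m n hm hn htm, key n m hn hm htn, mul_comm n m, mul_comm (n : ℝ) m]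

theorem exists_isC0Semigroup_of_localSemigroup [CompleteSpace X] (ht₀ : 0 < t₀)
    (hSc : ∀ x, Continuous fun t => S t x) (h0 : S 0 = 1)
    (hadd : ∀ s t, 0 ≤ s → 0 ≤ t → t + s ≤ t₀ → S (t + s) = S t * S s) :
    ∃ P : ℝ → X →L[𝕜] X, IsC0Semigroup P ∧ ∀ t ∈ Icc 0 t₀, P t = S t := by
  -- The added `1` keeps `N t` positive, also at `t = 0`; any other admissible number of pieces
  -- gives the same operator, by `hP`.
  let N : ℝ → ℕ := fun t => ⌈t / t₀⌉₊ + 1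
  have hN : ∀ t, t ≤ N t * t₀ := fun t => by
    rw [← div_le_iff₀ ht₀]
    push_cast [N]
    linarith [Nat.le_ceil (t / t₀)]
  have hP : ∀ {t : ℝ} {n : ℕ}, 0 ≤ t → 0 < n → t ≤ n * t₀ →
      S (t / N t) ^ N t = S (t / n) ^ n := fun ht hn htn =>
    localSemigroup_pow_eq_pow h0 hadd ht (Nat.succ_pos _) hn (hN _) htn
  refine ⟨fun t => S (t / N t) ^ N t, ⟨?_, ?_, ?_⟩, ?_⟩
  · simp only [zero_div, h0, one_pow]
    rfl
  · intro s t hs ht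
    have hn : 0 < N (s + t) := Nat.succ_pos _
    have hn' : (0 : ℝ) < N (s + t) := by exact_mod_cast hn
    have hst := hN (s + t)
    have hle : s / N (s + t) + t / N (s + t) ≤ t₀ := by
      rw [← add_div, div_le_iff₀ hn']; linarith
    rw [hP hs hn (by linarith), hP ht hn (by linarith), add_div,
      hadd _ _ (by positivity) (by positivity) hle, Commute.mul_pow]
    · rfl
    · rw [Commute, SemiconjBy, ← hadd _ _ (by positivity) (by positivity) hle, add_comm,
        hadd _ _ (by positivity) (by positivity) (by rwa [add_comm])]
  · intro x t ht
    -- The count `N (t + 1)` serves all times up to `t + 1`, so near `t` the extension is a fixed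
    -- power of a strongly continuous family.
    have hn : 0 < N (t + 1) := Nat.succ_pos _
    have hc : ∀ n : ℕ, Continuous fun s => (S (s / N (t + 1)) ^ n) x := by
      intro n
      induction n with
      | zero => exact continuous_const
      | succ n ih =>
        simp only [pow_succ']
        exact continuous_apply_of_continuous hSc (by fun_prop) ih
    refine ((hc (N (t + 1))).continuousWithinAt (s := Ici 0) (x := t)).congr_of_eventuallyEq ?_ ?_
    · have : ∀ᶠ s in 𝓝[Ici 0] t, s ≤ t + 1 :=
        nhdsWithin_le_nhds (Iic_mem_nhds (by linarith))
      filter_upwards [this, self_mem_nhdsWithin] with s hs hs0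
      rw [hP hs0 hn (hs.trans (hN _))]
    · rw [hP ht hn (le_trans (by linarith) (hN (t + 1)))]
  · intro t ht
    have := hP (n := 1) ht.1 one_pos (by simpa using ht.2)
    simpa using this

end LocalSemigroup

/-! ### Generator of the perturbed semigroup -/

namespace IsVolterra
variable [CompleteSpace X] [NormedSpace ℝ X] [IsScalarTower ℝ 𝕜 X] {A : X →ₗ.[𝕜] X}
  {T : ℝ → X →L[𝕜] X} {lam : 𝕜} {R K : X →L[𝕜] X} {t₀ : ℝ}
  {V : StrongCont 𝕜 X t₀ →L[𝕜] StrongCont 𝕜 X t₀}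

/-- Forward, `S(t)x - x - ∫₀ᵗ S(s)y ds` solves the homogeneous Volterra equation and so vanishes;
then `y` is the right derivative at `0`. Backward, `R` applied to the difference quotient of `S`
splits into that of `T` at `R x`, with limit `λRx - x`, and an averaged convolution, with limit `K
x`. -/
theorem generator_iff (hV : IsVolterra T R K V) (ht₀ : 0 < t₀) (hA : Generates A T)
    (hR : IsResolvent A lam R) {S : ℝ → X →L[𝕜] X} (hSs : IsC0Semigroup S)
    (hS : ∀ t ∈ Icc 0 t₀, ∀ x,
      R (S t x) = R (T t x) + ∫ s in (0 : ℝ)..t, T (t - s) (K (S s x))) (x y : X) :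
    lam • R x - x + K x = R y ↔
      Tendsto (fun h : ℝ => ((h : 𝕜))⁻¹ • (S h x - x)) (𝓝[>] 0) (𝓝 y) := by
  have hT := hA.isC0Semigroup
  have hKS : ∀ x, Continuous fun r => K (S (max r 0) x) := fun x =>
    K.continuous.comp (hSs.continuous_max x)
  have hS' : ∀ t ∈ Icc 0 t₀, ∀ x,
      R (S t x) = R (T t x) + ∫ s in (0 : ℝ)..t, T (t - s) (K (S (max s 0) x)) := by
    intro t ht x
    rw [hS t ht]
    congr 1
    refine intervalIntegral.integral_congr fun s hs => ?_
    rw [uIcc_of_le ht.1] at hs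
    have h0 : max s 0 = s := max_eq_left hs.1
    simp only [h0]
  constructor
  · intro hxy
    have key : ∀ t ∈ Icc 0 t₀, S t x - x - (∫ s in (0 : ℝ)..t, S (max s 0) y) = 0 := by
      intro t ht
      have hIc : Continuous fun t => ∫ s in (0 : ℝ)..t, S (max s 0) y :=
        intervalIntegral.continuous_primitive
          (fun a b => (hSs.continuous_max y).intervalIntegrable a b) 0
      have hz : ContinuousOn (fun t => S t x - x - (∫ s in (0 : ℝ)..t, S (max s 0) y))
          (Icc 0 t₀) :=
        (((hSs.continuousOn x).mono Icc_subset_Ici_self).sub continuousOn_const).sub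
          hIc.continuousOn
      refine hV.eq_zero_of_eq_convolution le_rfl hz (fun t ht => ?_) ht
      have e0 : ∫ s in (0 : ℝ)..t, T (t - s) (K (S s x - x - ∫ r in (0 : ℝ)..s, S (max r 0) y)) =
          (∫ s in (0 : ℝ)..t, T (t - s) (K (S (max s 0) x))) - (∫ s in (0 : ℝ)..t, T (t - s) (K x))
            - ∫ s in (0 : ℝ)..t, T (t - s) (∫ r in (0 : ℝ)..s, K (S (max r 0) y)) := by
        have i1 := convolution_integrable hT (hKS x) ht.1 le_rfl
        have i2 := convolution_integrable hT (continuous_const (y := K x)) ht.1 le_rfl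
        have i3 := convolution_integrable hT (g := fun s => ∫ r in (0 : ℝ)..s, K (S (max r 0) y))
          (intervalIntegral.continuous_primitive
            (fun a b => (hKS y).intervalIntegrable a b) 0) ht.1 le_rfl
        rw [← intervalIntegral.integral_sub i1 i2, ← intervalIntegral.integral_sub (i1.sub i2) i3]
        refine intervalIntegral.integral_congr fun s hs => ?_
        rw [uIcc_of_le ht.1] at hs
        have h0 : max s 0 = s := max_eq_left hs.1
        rw [h0, ContinuousLinearMap.intervalIntegral_comp_comm K
          ((hSs.continuous_max y).intervalIntegrable _ _), map_sub, map_sub, map_sub, map_sub]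
      have e1 : ∫ s in (0 : ℝ)..t, T (t - s) (K (S (max s 0) x)) = R (S t x) - R (T t x) := by
        rw [hS' t ht, add_sub_cancel_left]
      have iT := fun z => hT.intervalIntegrable le_rfl ht.1 z
      -- The only use of the equation relating `x` and `y`: it expresses `K x` through `R y`, `R x`
      -- and `x`.
      have e2 : ∫ s in (0 : ℝ)..t, T (t - s) (K x) =
          R (∫ s in (0 : ℝ)..t, T s y) - R (T t x - x) := by
        have hKx : K x = R y - (lam • R x - x) := by rw [← hxy]; abel
        have hI := fun z => ContinuousLinearMap.intervalIntegral_comp_comm R (iT z)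
        have hcomm : ∀ z, ∫ s in (0 : ℝ)..t, T s (R z) = R (∫ s in (0 : ℝ)..t, T s z) := by
          intro z
          rw [← hI z]
          refine intervalIntegral.integral_congr fun s hs => ?_
          rw [uIcc_of_le ht.1] at hs
          exact (hV.comm s hs.1 z).symm
        have hsplit : ∫ s in (0 : ℝ)..t, T s (K x) = (∫ s in (0 : ℝ)..t, T s (R y)) -
            (lam • (∫ s in (0 : ℝ)..t, T s (R x)) - ∫ s in (0 : ℝ)..t, T s x) := by
          have iL : IntervalIntegrable (fun s => lam • T s (R x)) MeasureTheory.volume 0 t :=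
            (iT (R x)).smul lam
          rw [← intervalIntegral.integral_smul, ← intervalIntegral.integral_sub iL (iT x),
            ← intervalIntegral.integral_sub (iT (R y)) (iL.sub (iT x))]
          simp only [hKx, map_sub, map_smul]
        have h3 := hR.integral_apply hA ht.1 x
        rw [map_sub, map_smul] at h3
        rw [convolution_const, hsplit, hcomm, hcomm]
        nth_rw 2 [h3]
        abel
      have e3 : ∫ s in (0 : ℝ)..t, T (t - s) (∫ r in (0 : ℝ)..s, K (S (max r 0) y)) =
          R (∫ s in (0 : ℝ)..t, S (max s 0) y) - R (∫ s in (0 : ℝ)..t, T s y) := by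
        have iS := (hSs.continuous_max y).intervalIntegrable (μ := MeasureTheory.volume) 0 t
        rw [convolution_integral hT (hKS y) ht.1, ← map_sub, ← intervalIntegral.integral_sub iS
          (iT y), ← ContinuousLinearMap.intervalIntegral_comp_comm R (iS.sub (iT y))]
        refine intervalIntegral.integral_congr fun s hs => ?_
        rw [uIcc_of_le ht.1] at hs
        have h0 : max s 0 = s := max_eq_left hs.1
        rw [h0, map_sub, hS' s ⟨hs.1, hs.2.trans ht.2⟩, add_sub_cancel_left]
      rw [e0, e1, e2, e3]
      simp only [map_sub]
      abel
    have h1 := tendsto_inv_smul_integral (hSs.continuous_max y) 0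
    simp only [max_self, hSs.apply_zero, zero_add] at h1
    refine h1.congr' ?_
    filter_upwards [Ioo_mem_nhdsGT ht₀] with h hh
    rw [ofReal_inv_smul, sub_eq_zero.1 (key h ⟨hh.1.le, hh.2.le⟩)]
  · intro hlim
    have h1 := (R.continuous.tendsto y).comp hlim
    refine tendsto_nhds_unique (Tendsto.congr' (f₁ := fun h : ℝ => ((h : 𝕜))⁻¹ •
      (T h (R x) - R x) + h⁻¹ • ∫ s in (0 : ℝ)..h, T (h - s) (K (S (max s 0) x))) ?_ ?_) h1
    · filter_upwards [Ioo_mem_nhdsGT ht₀] with h hh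
      simp only [Function.comp]
      rw [map_smul, map_sub, hS' h ⟨hh.1.le, hh.2.le⟩, hV.comm h hh.1.le, ofReal_inv_smul,
        ofReal_inv_smul, ← smul_add]
      congr 1
      abel
    · have h2 := tendsto_inv_smul_convolution hT (hKS x)
      simp only [max_self, hSs.apply_zero] at h2
      exact ((hA.mem_graph_iff _ _).1 (hR.mem_graph x)).add h2

/-- The semigroup of a Desch–Schappacher perturbation, its generator, and its distance to the
unperturbed semigroup on `[0, t₀]`. -/
theorem exists_perturbedSemigroup (hV : IsVolterra T R K V) (ht₀ : 0 < t₀) (hA : Generates A T)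
    (hR : IsResolvent A lam R) :
    ∃ S : ℝ → X →L[𝕜] X, IsC0Semigroup S ∧
      (∀ x y : X, lam • R x - x + K x = R y ↔
        Tendsto (fun h : ℝ => ((h : 𝕜))⁻¹ • (S h x - x)) (𝓝[>] 0) (𝓝 y)) ∧
      ∀ C, (∀ t ∈ Icc 0 t₀, ‖T t‖ ≤ C) → ∀ t ∈ Icc 0 t₀,
        ‖S t - T t‖ ≤ ‖V‖ * (C / (1 - ‖V‖)) := by
  obtain ⟨S, hSc, hS, hSn⟩ := hV.exists_fixedPoint ht₀.le
  have h0 : S 0 = 1 := by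
    ext x
    have := hS 0 ⟨le_rfl, ht₀.le⟩ x
    rw [intervalIntegral.integral_same, add_zero] at this
    rw [hV.injective this, hV.isC0Semigroup.apply_zero]
    rfl
  obtain ⟨P, hP, hPS⟩ := exists_isC0Semigroup_of_localSemigroup ht₀ hSc h0
    fun s t hs ht hst => hV.fixedPoint_add hSc hS hs ht hst
  refine ⟨P, hP, hV.generator_iff ht₀ hA hR hP fun t ht x => ?_, fun C hC t ht => ?_⟩
  · rw [hPS t ht, hS t ht x]
    congr 1
    refine intervalIntegral.integral_congr fun s hs => ?_
    rw [uIcc_of_le ht.1] at hs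
    simp only [hPS s ⟨hs.1, hs.2.trans ht.2⟩]
  · rw [hPS t ht]
    exact hSn C hC t ht

end IsVolterra

/-! ### Powers of operators -/

theorem norm_pow_le_pow_norm (P : X →L[𝕜] X) (n : ℕ) : ‖P ^ n‖ ≤ ‖P‖ ^ n := by
  induction n with
  | zero =>
    rw [pow_zero, pow_zero]
    -- Only an inequality holds, since `X` may be trivial.
    exact ContinuousLinearMap.norm_id_le
  | succ n ih =>
    rw [pow_succ, pow_succ]
    exact (norm_mul_le _ _).trans (by gcongr)

theorem norm_pow_sub_pow_le {P Q : X →L[𝕜] X} {C : ℝ} (hC : 1 ≤ C) (hP : ‖P‖ ≤ C)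
    (hQ : ‖Q‖ ≤ C) (n : ℕ) : ‖P ^ n - Q ^ n‖ ≤ n * C ^ n * ‖P - Q‖ := by
  induction n with
  | zero => simp
  | succ n ih =>
    have e : P ^ (n + 1) - Q ^ (n + 1) = P * (P ^ n - Q ^ n) + (P - Q) * Q ^ n := by
      rw [pow_succ', pow_succ', mul_sub, sub_mul]
      abel
    have hQn : ‖Q ^ n‖ ≤ C ^ n := (norm_pow_le_pow_norm Q n).trans (by gcongr)
    have hCn : C ^ n ≤ C ^ (n + 1) := pow_le_pow_right₀ hC n.le_succ
    rw [e]
    calc ‖P * (P ^ n - Q ^ n) + (P - Q) * Q ^ n‖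
        ≤ ‖P‖ * ‖P ^ n - Q ^ n‖ + ‖P - Q‖ * ‖Q ^ n‖ :=
          (norm_add_le _ _).trans (add_le_add (norm_mul_le _ _) (norm_mul_le _ _))
      _ ≤ C * (n * C ^ n * ‖P - Q‖) + ‖P - Q‖ * C ^ (n + 1) := by
          gcongr
          exact hQn.trans hCn
      _ = (n + 1 : ℕ) * C ^ (n + 1) * ‖P - Q‖ := by push_cast; ring

/-- Power stability with a given rate is stable under small perturbations of the operator. -/
theorem exists_norm_pow_le_of_norm_sub_lt {P₀ : X →L[𝕜] X} {M q₀ q : ℝ} (hq₀ : 0 < q₀)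
    (hq : q₀ < q) (h : ∀ k : ℕ, ‖P₀ ^ k‖ ≤ M * q₀ ^ k) :
    ∃ δ > 0, ∀ P : X →L[𝕜] X, ‖P - P₀‖ < δ → ∃ C, 0 ≤ C ∧ ∀ k : ℕ, ‖P ^ k‖ ≤ C * q ^ k := by
  have hq0 : 0 < q := hq₀.trans hq
  -- A single strict inequality `‖P₀ⁿ‖ < qⁿ` is open in the operator and controls all powers through
  -- `k = n (k / n) + k % n`.
  obtain ⟨n, hn0, hn⟩ : ∃ n : ℕ, 0 < n ∧ ‖P₀ ^ n‖ < q ^ n := by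
    have h1 : Tendsto (fun n : ℕ => M * (q₀ / q) ^ n) atTop (𝓝 (M * 0)) :=
      (tendsto_pow_atTop_nhds_zero_of_lt_one (by positivity)
        ((div_lt_one hq0).2 hq)).const_mul M
    rw [mul_zero] at h1
    obtain ⟨n, hn, hn0⟩ := ((h1.eventually_lt_const one_pos).and (eventually_gt_atTop 0)).exists
    refine ⟨n, hn0, (h n).trans_lt ?_⟩
    rwa [div_pow, ← mul_div_assoc, div_lt_one (by positivity)] at hn
  have hc : ∀ᶠ P in 𝓝 P₀, ‖P ^ n‖ < q ^ n :=
    ((continuous_pow n).norm.tendsto P₀).eventually_lt_const hn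
  obtain ⟨δ, hδ, hball⟩ := Metric.eventually_nhds_iff.1 hc
  refine ⟨δ, hδ, fun P hP => ?_⟩
  have hPn := (hball (by rwa [dist_eq_norm])).le
  obtain ⟨C, hC⟩ := ((finite_Iio n).image fun r => ‖P ^ r‖ / q ^ r).bddAbove
  refine ⟨max C 0, le_max_right _ _, fun k => ?_⟩
  have hr : ‖P ^ (k % n)‖ ≤ max C 0 * q ^ (k % n) := by
    rw [← div_le_iff₀ (by positivity)]
    exact (hC ⟨k % n, Nat.mod_lt k hn0, rfl⟩).trans (le_max_left _ _)
  calc ‖P ^ k‖ = ‖(P ^ n) ^ (k / n) * P ^ (k % n)‖ := by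
        rw [← pow_mul, ← pow_add, Nat.div_add_mod]
    _ ≤ ‖P ^ n‖ ^ (k / n) * ‖P ^ (k % n)‖ :=
        (norm_mul_le _ _).trans (by gcongr; exact norm_pow_le_pow_norm _ _)
    _ ≤ (q ^ n) ^ (k / n) * (max C 0 * q ^ (k % n)) := by gcongr
    _ = max C 0 * q ^ k := by
        rw [mul_left_comm, ← pow_mul, ← pow_add, Nat.div_add_mod]

/-! ### The discrete-time system -/

namespace IsC0Semigroup
variable {S T : ℝ → X →L[𝕜] X}

theorem apply_div_pow (hS : IsC0Semigroup S) {t : ℝ} (ht : 0 ≤ t) {n : ℕ} (hn : 0 < n) :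
    S t = S (t / n) ^ n := by
  have hn' : (0 : ℝ) < n := by exact_mod_cast hn
  rw [← localSemigroup_pow (t₀ := t) hS.map_zero
    (fun s t hs ht _ => hS.map_add t s ht hs) n (by positivity)
    (mul_div_cancel₀ t hn'.ne').le, mul_div_cancel₀ t hn'.ne']

/-- Writing both semigroups at `t` as `n`-th powers at `t / n` carries closeness from `[0, t₀]` to
`[0, n t₀]`. -/
theorem norm_sub_le_of_norm_sub_le (hS : IsC0Semigroup S) (hT : IsC0Semigroup T) {t₀ C δ : ℝ}
    (hC : 1 ≤ C) {n : ℕ} (hn : 0 < n) (hSC : ∀ t ∈ Icc 0 t₀, ‖S t‖ ≤ C)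
    (hTC : ∀ t ∈ Icc 0 t₀, ‖T t‖ ≤ C) (h : ∀ t ∈ Icc 0 t₀, ‖S t - T t‖ ≤ δ) {t : ℝ}
    (ht : t ∈ Icc 0 (n * t₀)) : ‖S t - T t‖ ≤ n * C ^ n * δ := by
  have hn' : (0 : ℝ) < n := by exact_mod_cast hn
  have htn : t / n ∈ Icc 0 t₀ :=
    ⟨div_nonneg ht.1 hn'.le, by rw [div_le_iff₀ hn']; linarith [ht.2]⟩
  rw [hS.apply_div_pow ht.1 hn, hT.apply_div_pow ht.1 hn]
  refine (norm_pow_sub_pow_le hC (hSC _ htn) (hTC _ htn) n).trans ?_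
  gcongr
  exact h _ htn

/-- The operator that maps the state at a sampling time to the state `t` time units later, where
`L` is the composition of the feedback, the control operator and the resolvent at `lam`. -/
def step [CompleteSpace X] [NormedSpace ℝ X] [IsScalarTower ℝ 𝕜 X] (hS : IsC0Semigroup S)
    (lam : 𝕜) (L : X →L[𝕜] X) (t : ℝ) : X →L[𝕜] X :=
  S t + (lam • hS.integral t - S t + 1) * L

variable [CompleteSpace X] [NormedSpace ℝ X] [IsScalarTower ℝ 𝕜 X]

theorem step_apply (hS : IsC0Semigroup S) (lam : 𝕜) (L : X →L[𝕜] X) {t : ℝ} (ht : 0 ≤ t) (x : X) :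
    hS.step lam L t x =
      S t x + (lam • (∫ s in (0 : ℝ)..t, S s (L x)) - S t (L x) + L x) := by
  rw [← hS.integral_apply ht]
  rfl

theorem step_zero (hS : IsC0Semigroup S) (lam : 𝕜) (L : X →L[𝕜] X) (x : X) :
    hS.step lam L 0 x = x := by
  rw [hS.step_apply lam L le_rfl, intervalIntegral.integral_same, hS.apply_zero, hS.apply_zero,
    smul_zero, zero_sub, neg_add_cancel, add_zero]

theorem exists_norm_step_le (hS : IsC0Semigroup S) (lam : 𝕜) (L : X →L[𝕜] X) (τ : ℝ) :
    ∃ C, 0 ≤ C ∧ ∀ t ∈ Icc 0 τ, ‖hS.step lam L t‖ ≤ C := by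
  refine exists_norm_le_of_continuousOn isCompact_Icc fun x => ?_
  have hI : Continuous fun t => ∫ s in (0 : ℝ)..t, S (max s 0) (L x) :=
    intervalIntegral.continuous_primitive
      (fun a b => (hS.continuous_max (L x)).intervalIntegrable a b) 0
  have hc : Continuous fun t => S (max t 0) x + (lam • (∫ s in (0 : ℝ)..t, S (max s 0) (L x)) -
      S (max t 0) (L x) + L x) :=
    (hS.continuous_max x).add
      (((hI.const_smul lam).sub (hS.continuous_max (L x))).add continuous_const)
  refine hc.continuousOn.congr fun t ht => ?_
  simp only [hS.step_apply lam L ht.1, integral_max ht.1, max_eq_left ht.1]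

end IsC0Semigroup

theorem isResolvent_of_mem_graph_iff {A : X →ₗ.[𝕜] X} {lam : 𝕜} {R : X →L[𝕜] X}
    (h : ∀ x y, (x, y) ∈ A.graph ↔ R (lam • x - y) = x) : IsResolvent A lam R := by
  refine ⟨fun y => ?_, fun x => (h _ _).1 (A.mem_graph x)⟩
  have hg : (R y, lam • R y - y) ∈ A.graph := (h _ _).2 (by rw [sub_sub_cancel])
  obtain ⟨z, hz, hz'⟩ := (LinearPMap.mem_graph_iff _).1 hg
  simp only at hz hz'
  refine ⟨hz ▸ z.2, ?_⟩
  have e : (⟨R y, hz ▸ z.2⟩ : A.domain) = z := Subtype.ext hz.symm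
  rw [e, hz', sub_sub_cancel]

/-! ### The sampled-data system in resolvent coordinates -/

section System
variable [CompleteSpace X] {A : X →ₗ.[𝕜] X} {T S : ℝ → X →L[𝕜] X} {lam : 𝕜}

/-- The operator `(lam I - A₋₁)⁻¹ D`. -/
def resolventComp {Y : Type*} [NormedAddCommGroup Y] [NormedSpace 𝕜 Y] (hA : Generates A T)
    (hlam : lam ∈ opResolventSet A) (D : Y →L[𝕜] Extrap A lam) : Y →L[𝕜] X :=
  (extrapEquiv hA hlam).toContinuousLinearEquiv.toContinuousLinearMap.comp D

variable (hA : Generates A T) (hlam : lam ∈ opResolventSet A)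

theorem resolventComp_apply {Y : Type*} [NormedAddCommGroup Y] [NormedSpace 𝕜 Y]
    (D : Y →L[𝕜] Extrap A lam) (y : Y) :
    resolventComp hA hlam D y = extrapEquiv hA hlam (D y) := rfl

/-- This is the factorization `λ - A_D = (λ - A₋₁)(1 - K)`, with `H` the inverse of `1 - K`. -/
theorem isResolvent_perturbedGen {D : X →L[𝕜] Extrap A lam} {H : X →L[𝕜] X}
    (hH : H * (1 - resolventComp hA hlam D) = 1) (hH' : (1 - resolventComp hA hlam D) * H = 1) :
    IsResolvent (perturbedGen A lam D) lam (H * opResolvent A lam) := by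
  refine isResolvent_of_mem_graph_iff fun x y => ?_
  have h1 : ∀ z, H (z - resolventComp hA hlam D z) = z := DFunLike.congr_fun hH
  have h2 : ∀ z, H z - resolventComp hA hlam D (H z) = z := DFunLike.congr_fun hH'
  rw [mem_perturbedGen_graph_iff hA hlam, ← resolventComp_apply]
  change _ ↔ H (opResolvent A lam (lam • x - y)) = x
  rw [map_sub, map_smul]
  constructor
  · intro h
    rw [← h, ← sub_sub, sub_sub_cancel]
    exact h1 x
  · intro h
    have h3 := h2 (lam • opResolvent A lam x - opResolvent A lam y)
    rw [h] at h3
    rw [sub_add, h3, sub_sub_cancel]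

variable [NormedSpace ℝ X] [IsScalarTower ℝ 𝕜 X]

/-- In resolvent coordinates `S₋₁(s)` is `(1 - K) S(s) H`, because `S(s)` commutes with `HR`. The
integral of an orbit of `S` lies in the range of `HR`, and `(1 - K)` cancels `H`, leaving `R` of an
element of `X`; injectivity of `R` then removes `R`. -/
theorem incl_eq_incl_add_integral_iff {D : X →L[𝕜] Extrap A lam} {H : X →L[𝕜] X}
    (hH : H * (1 - resolventComp hA hlam D) = 1) (hH' : (1 - resolventComp hA hlam D) * H = 1)
    (hS : Generates (perturbedGen A lam D) S) (B : U →L[𝕜] Extrap A lam) (F : X →L[𝕜] U) {t : ℝ}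
    (ht : 0 ≤ t) (x y : X) :
    incl A lam y = incl A lam (S t x) +
        (∫ s in (0 : ℝ)..t, extendOp A lam (S s) (B (F x))) ↔
      y = hS.isC0Semigroup.step lam (H * (resolventComp hA hlam B).comp F) t x := by
  have hR := isResolvent_perturbedGen hA hlam hH hH'
  have h2 : ∀ z, (1 - resolventComp hA hlam D) (H z) = z := DFunLike.congr_fun hH'
  set f : X := H (resolventComp hA hlam B (F x)) with hf
  have e1 : extrapEquiv hA hlam (∫ s in (0 : ℝ)..t, extendOp A lam (S s) (B (F x))) =
      (1 - resolventComp hA hlam D) (∫ s in (0 : ℝ)..t, S s f) := by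
    rw [extrapEquiv_intervalIntegral, ← ContinuousLinearMap.intervalIntegral_comp_comm _
      (hS.isC0Semigroup.intervalIntegrable le_rfl ht f)]
    refine intervalIntegral.integral_congr fun s hs => ?_
    rw [uIcc_of_le ht] at hs
    refine extrapEquiv_extendOp hA hlam (S' := (1 - resolventComp hA hlam D) * S s * H)
      (fun z => ?_) (B (F x))
    change (1 - resolventComp hA hlam D) (S s ((H * opResolvent A lam) z)) = _
    rw [← hR.apply_comm hS hs.1]
    exact h2 _
  have e2 := hR.integral_apply hS ht f
  rw [incl_eq_iff hA hlam, map_add, extrapEquiv_incl, e1, e2]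
  change _ = _ + (1 - resolventComp hA hlam D) (H (opResolvent A lam _)) ↔ _
  rw [h2, ← map_add, (isResolvent_opResolvent hlam).injective.eq_iff,
    hS.isC0Semigroup.step_apply lam _ ht, sub_sub_eq_add_sub, add_sub_right_comm]
  rfl

theorem isSolution_iff {D : X →L[𝕜] Extrap A lam} {H : X →L[𝕜] X}
    (hH : H * (1 - resolventComp hA hlam D) = 1) (hH' : (1 - resolventComp hA hlam D) * H = 1)
    (hS : Generates (perturbedGen A lam D) S) (B : U →L[𝕜] Extrap A lam) (F : X →L[𝕜] U) {τ : ℝ}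
    (x0 : X) (x : ℝ → X) :
    IsSolution A lam S B F τ x0 x ↔ x 0 = x0 ∧ ∀ (k : ℕ) (t : ℝ), 0 < t → t ≤ τ →
      x (k * τ + t) =
        hS.isC0Semigroup.step lam (H * (resolventComp hA hlam B).comp F) t (x (k * τ)) :=
  ⟨fun h => ⟨h.init, fun k t ht htτ =>
    (incl_eq_incl_add_integral_iff hA hlam hH hH' hS B F ht.le _ _).1 (h.step k t ht htτ)⟩,
  fun h => ⟨h.1, fun k t ht htτ =>
    (incl_eq_incl_add_integral_iff hA hlam hH hH' hS B F ht.le _ _).2 (h.2 k t ht htτ)⟩⟩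

end System

/-! ### Solutions of the recursion and their decay -/

section Recursion
variable {E : ℝ → X →L[𝕜] X} {τ : ℝ} {x : ℝ → X}

theorem eq_pow_apply_of_recursion (hτ : 0 < τ)
    (h : ∀ (k : ℕ) (t : ℝ), 0 < t → t ≤ τ → x (k * τ + t) = E t (x (k * τ))) (k : ℕ) :
    x (k * τ) = (E τ ^ k) (x 0) := by
  induction k with
  | zero => simp
  | succ k ih =>
    rw [Nat.cast_succ, add_mul, one_mul, h k τ hτ le_rfl, ih, pow_succ']
    rfl

theorem exists_recursion (hτ : 0 < τ) (h0 : ∀ x, E 0 x = x) (x0 : X) :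
    ∃ x : ℝ → X, x 0 = x0 ∧
      ∀ (k : ℕ) (t : ℝ), 0 < t → t ≤ τ → x (k * τ + t) = E t (x (k * τ)) := by
  let x : ℝ → X := fun t => E (t - ⌊t / τ⌋₊ * τ) ((E τ ^ ⌊t / τ⌋₊) x0)
  have hx : ∀ (k : ℕ) (t : ℝ), 0 ≤ t → t < τ → x (k * τ + t) = E t ((E τ ^ k) x0) := by
    intro k t ht htτ
    have hk : ⌊(k * τ + t) / τ⌋₊ = k := by
      rw [Nat.floor_eq_iff (by positivity), le_div_iff₀ hτ, div_lt_iff₀ hτ]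
      constructor <;> linarith
    simp only [x, hk, add_sub_cancel_left]
  have hx0 : ∀ k : ℕ, x (k * τ) = (E τ ^ k) x0 := fun k => by
    simpa [h0] using hx k 0 le_rfl hτ
  refine ⟨x, by simpa using hx0 0, fun k t ht htτ => ?_⟩
  -- The endpoint `t = τ` belongs to the next period in the floor formula; `E 0 = id` makes the two
  -- descriptions agree.
  rcases htτ.lt_or_eq with h | rfl
  · rw [hx k t ht.le h, hx0]
  · have := hx0 (k + 1)
    rw [Nat.cast_succ, add_mul, one_mul] at this
    rw [this, hx0, pow_succ']
    rfl

theorem norm_le_of_recursion (hτ : 0 < τ) (h0 : ∀ x, E 0 x = x) {C₁ C q : ℝ} (hC₁ : 0 ≤ C₁)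
    (hC : 0 ≤ C) (hq : 0 ≤ q) (hE : ∀ t ∈ Icc 0 τ, ‖E t‖ ≤ C₁)
    (hpow : ∀ k : ℕ, ‖E τ ^ k‖ ≤ C * Real.exp (-q * τ) ^ k)
    (h : ∀ (k : ℕ) (t : ℝ), 0 < t → t ≤ τ → x (k * τ + t) = E t (x (k * τ))) {t : ℝ}
    (ht : 0 ≤ t) : ‖x t‖ ≤ C₁ * C * Real.exp (q * τ) * Real.exp (-q * t) * ‖x 0‖ := by
  set k := ⌊t / τ⌋₊
  have hk1 : k * τ ≤ t := (le_div_iff₀ hτ).1 (Nat.floor_le (by positivity))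
  have hk2 : t < k * τ + τ := by
    have := (div_lt_iff₀ hτ).1 (Nat.lt_floor_add_one (t / τ))
    linarith
  have e : x t = E (t - k * τ) ((E τ ^ k) (x 0)) := by
    rw [← eq_pow_apply_of_recursion hτ h]
    rcases hk1.lt_or_eq with h1 | h1
    · rw [← h k (t - k * τ) (by linarith) (by linarith), add_sub_cancel]
    · rw [← h1, sub_self, h0]
  -- The factor `e^{qτ}` pays for `t` being up to one period later than `kτ`; this needs `q ≥ 0`.
  have hexp : Real.exp (-q * τ) ^ k ≤ Real.exp (q * τ) * Real.exp (-q * t) := by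
    rw [← Real.exp_nat_mul, ← Real.exp_add]
    refine Real.exp_le_exp.2 ?_
    nlinarith
  calc ‖x t‖ ≤ ‖E (t - k * τ)‖ * (‖E τ ^ k‖ * ‖x 0‖) := by
        rw [e]
        exact (ContinuousLinearMap.le_opNorm _ _).trans
          (by gcongr; exact ContinuousLinearMap.le_opNorm _ _)
    _ ≤ C₁ * (C * Real.exp (-q * τ) ^ k * ‖x 0‖) := by
        gcongr
        · exact hE _ ⟨by linarith, by linarith⟩
        · exact hpow k
    _ ≤ C₁ * (C * (Real.exp (q * τ) * Real.exp (-q * t)) * ‖x 0‖) := by gcongr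
    _ = _ := by ring

end Recursion

/-! ### Stability in terms of powers, and continuity in the perturbation -/

theorem generates_of_generates_perturbedGen_zero [CompleteSpace X] {A : X →ₗ.[𝕜] X}
    {T S : ℝ → X →L[𝕜] X} {lam : 𝕜} (hA : Generates A T) (hlam : lam ∈ opResolventSet A)
    (hS : Generates (perturbedGen A lam 0) S) :
    Generates A S := by
  refine ⟨hS.isC0Semigroup, fun x y => ?_⟩
  rw [← hS.mem_graph_iff, mem_perturbedGen_graph_iff hA hlam,
    (isResolvent_opResolvent hlam).mem_graph_iff, zero_apply, map_zero, add_zero, map_sub,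
    map_smul, sub_eq_iff_eq_add, sub_eq_iff_eq_add, add_comm]

theorem incl_smul_eq_volterra [CompleteSpace X] {A : X →ₗ.[𝕜] X}
    {T : ℝ → X →L[𝕜] X} {lam : 𝕜} {t₀ : ℝ} {D : X →L[𝕜] Extrap A lam}
    {V : StrongCont 𝕜 X t₀ →L[𝕜] StrongCont 𝕜 X t₀}
    (hV : ∀ (Q : StrongCont 𝕜 X t₀) (t : Icc (0 : ℝ) t₀) (x : X),
      incl A lam (V Q t x) = volterra A lam T D Q t x) (c : 𝕜) (Q : StrongCont 𝕜 X t₀)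
    (t : Icc (0 : ℝ) t₀) (x : X) :
    incl A lam ((c • V) Q t x) = volterra A lam T (c • D) Q t x := by
  change incl A lam (c • V Q t x) = _
  rw [map_smul, hV, volterra, volterra, ← intervalIntegral.integral_smul]
  simp only [smul_apply, map_smul]

section Perturbation
variable [CompleteSpace X] [NormedSpace ℝ X] [IsScalarTower ℝ 𝕜 X] {A : X →ₗ.[𝕜] X}
  {T S : ℝ → X →L[𝕜] X} {lam : 𝕜} (hA : Generates A T) (hlam : lam ∈ opResolventSet A)

theorem expStable_of_norm_pow_le {D : X →L[𝕜] Extrap A lam} {H : X →L[𝕜] X}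
    (hD : ∃ t₀ > 0, D ∈ DeschSchappacher A lam T t₀)
    (hH : H * (1 - resolventComp hA hlam D) = 1) (hH' : (1 - resolventComp hA hlam D) * H = 1)
    (hS : Generates (perturbedGen A lam D) S) (B : U →L[𝕜] Extrap A lam) (F : X →L[𝕜] U)
    {τ ω q C : ℝ} (hτ : 0 < τ) (hω : 0 ≤ ω) (hq : ω < q) (hC : 0 ≤ C)
    (hpow : ∀ k : ℕ, ‖hS.isC0Semigroup.step lam (H * (resolventComp hA hlam B).comp F) τ ^ k‖ ≤
      C * Real.exp (-q * τ) ^ k) : ExpStable A lam T D B F τ ω := by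
  set L := H * (resolventComp hA hlam B).comp F
  have h0 := hS.isC0Semigroup.step_zero lam L
  obtain ⟨C₁, hC₁, hE⟩ := hS.isC0Semigroup.exists_norm_step_le lam L τ
  refine ⟨hD, S, hS, max 1 (C₁ * C * Real.exp (q * τ)), le_max_left _ _, q, hq, fun x0 =>
    ⟨?_, fun x hx t ht => ?_⟩⟩
  · obtain ⟨x, hx⟩ := exists_recursion hτ h0 x0
    exact ⟨x, (isSolution_iff hA hlam hH hH' hS B F x0 x).2 hx⟩
  · obtain ⟨rfl, hrec⟩ := (isSolution_iff hA hlam hH hH' hS B F x0 x).1 hx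
    refine (norm_le_of_recursion hτ h0 hC₁ hC (hω.trans hq.le) hE hpow hrec ht).trans ?_
    gcongr
    exact le_max_right _ _

theorem norm_step_pow_le_of_expStable
    (hS : Generates (perturbedGen A lam 0) S) (B : U →L[𝕜] Extrap A lam) (F : X →L[𝕜] U)
    {τ M q : ℝ} (hτ : 0 < τ) (hM : 0 ≤ M)
    (h : ∀ x0 : X, (∃ x : ℝ → X, IsSolution A lam S B F τ x0 x) ∧
      ∀ x : ℝ → X, IsSolution A lam S B F τ x0 x →
        ∀ t : ℝ, 0 ≤ t → ‖x t‖ ≤ M * Real.exp (-q * t) * ‖x0‖) (k : ℕ) :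
    ‖hS.isC0Semigroup.step lam ((resolventComp hA hlam B).comp F) τ ^ k‖ ≤
      M * Real.exp (-q * τ) ^ k := by
  have hK : (1 : X →L[𝕜] X) - resolventComp hA hlam 0 = 1 := by
    ext x
    simp [resolventComp_apply]
  refine ContinuousLinearMap.opNorm_le_bound _ (by positivity) fun x0 => ?_
  obtain ⟨x, hx⟩ := (h x0).1
  have h1 := (h x0).2 x hx (k * τ) (by positivity)
  obtain ⟨h2, h3⟩ := (isSolution_iff hA hlam (H := 1) (by rw [hK, one_mul])
    (by rw [hK, one_mul]) hS B F x0 x).1 hx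
  rw [one_mul] at h3
  rw [eq_pow_apply_of_recursion hτ h3, h2] at h1
  refine h1.trans_eq ?_
  rw [← Real.exp_nat_mul]
  ring_nf

theorem isVolterra_of_incl_eq_volterra {t₀ : ℝ} {D : X →L[𝕜] Extrap A lam}
    {V : StrongCont 𝕜 X t₀ →L[𝕜] StrongCont 𝕜 X t₀}
    (hV : ∀ (Q : StrongCont 𝕜 X t₀) (t : Icc (0 : ℝ) t₀) (x : X),
      incl A lam (V Q t x) = volterra A lam T D Q t x) (hV1 : ‖V‖ < 1) :
    IsVolterra T (opResolvent A lam) (resolventComp hA hlam D) V where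
  isC0Semigroup := hA.isC0Semigroup
  injective := (isResolvent_opResolvent hlam).injective
  comm t ht := (isResolvent_opResolvent hlam).apply_comm hA ht
  apply Q t x := by
    rw [(incl_eq_iff hA hlam).1 (hV Q t x), extrapEquiv_volterra hA hlam D Q t.2.1]
    rfl
  norm_lt_one := hV1

end Perturbation

/-- The one-period operator is a polynomial in `S(τ)`, `∫₀^τ S` and `L`, hence norm continuous in
these three. -/
theorem IsC0Semigroup.exists_norm_step_sub_lt [CompleteSpace X] [NormedSpace ℝ X]
    [IsScalarTower ℝ 𝕜 X] {T : ℝ → X →L[𝕜] X} (hT : IsC0Semigroup T) (lam : 𝕜) (L : X →L[𝕜] X)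
    {τ δ : ℝ} (hτ : 0 ≤ τ) (hδ : 0 < δ) :
    ∃ ε > 0, ∀ (S : ℝ → X →L[𝕜] X) (hS : IsC0Semigroup S) (L' : X →L[𝕜] X),
      (∀ t ∈ Icc 0 τ, ‖S t - T t‖ ≤ ε) → ‖L' - L‖ ≤ ε →
        ‖hS.step lam L' τ - hT.step lam L τ‖ < δ := by
  let Φ : (X →L[𝕜] X) × (X →L[𝕜] X) × (X →L[𝕜] X) → X →L[𝕜] X :=
    fun p => p.1 + (lam • p.2.1 - p.1 + 1) * p.2.2
  have hΦ : Continuous Φ := by fun_prop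
  obtain ⟨η, hη, h⟩ := Metric.continuous_iff.1 hΦ (T τ, hT.integral τ, L) δ hδ
  -- Chosen so that both `ε` and `ε τ`, the bound for the integrals, are below `η`.
  refine ⟨η / (2 * (τ + 1)), by positivity, fun S hS L' hST hL => ?_⟩
  have hle : η / (2 * (τ + 1)) < η := by
    rw [div_lt_iff₀ (by positivity)]
    nlinarith
  have hint : η / (2 * (τ + 1)) * τ < η := by
    rw [div_mul_eq_mul_div, div_lt_iff₀ (by positivity)]
    nlinarith
  rw [← dist_eq_norm]
  refine h (S τ, hS.integral τ, L') ?_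
  rw [Prod.dist_eq, Prod.dist_eq, max_lt_iff, max_lt_iff, dist_eq_norm, dist_eq_norm, dist_eq_norm]
  exact ⟨(hST τ ⟨hτ, le_rfl⟩).trans_lt hle,
    (norm_integral_sub_le hS hT hτ (by positivity) hST).trans_lt hint, hL.trans_lt hle⟩

/-- Desch–Schappacher perturbations `c D` with small `c` generate semigroups that are uniformly
close to the unperturbed one on bounded intervals. -/
theorem exists_generates_perturbedGen_smul [CompleteSpace X] [NormedSpace ℝ X]
    [IsScalarTower ℝ 𝕜 X] {A : X →ₗ.[𝕜] X} {T : ℝ → X →L[𝕜] X} {lam : 𝕜} (hA : Generates A T)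
    (hlam : lam ∈ opResolventSet A) {t₀ : ℝ} (ht₀ : 0 < t₀) {D : X →L[𝕜] Extrap A lam}
    (hD : D ∈ DeschSchappacher A lam T t₀) (τ : ℝ) :
    ∃ C, 0 ≤ C ∧ ∀ c : ℝ, 0 ≤ c → c ≤ 1 →
      (c : 𝕜) • D ∈ DeschSchappacher A lam T t₀ ∧
      ∃ S : ℝ → X →L[𝕜] X, Generates (perturbedGen A lam ((c : 𝕜) • D)) S ∧
        ∀ t ∈ Icc 0 τ, ‖S t - T t‖ ≤ C * c := by
  obtain ⟨V, hV, hV1⟩ := hD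
  have hT := hA.isC0Semigroup
  obtain ⟨C, hC0, hC⟩ := hT.exists_norm_le t₀
  have h1V : 0 < 1 - ‖V‖ := sub_pos.2 hV1
  set K := C / (1 - ‖V‖) with hK
  have hK0 : 0 ≤ K := by positivity
  obtain ⟨N, hN, hτN⟩ : ∃ N : ℕ, 0 < N ∧ τ ≤ N * t₀ := by
    refine ⟨⌈τ / t₀⌉₊ + 1, Nat.succ_pos _, ?_⟩
    rw [← div_le_iff₀ ht₀]
    push_cast
    linarith [Nat.le_ceil (τ / t₀)]
  -- For `c ≤ 1` one has `‖S - T‖ ≤ cK` on `[0, t₀]`, so `1 + C + K` bounds both semigroups there;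
  -- `N` pieces cover `[0, τ]`.
  refine ⟨N * (1 + C + K) ^ N * K, by positivity, fun c hc0 hc1 => ?_⟩
  have hcn : ‖(c : 𝕜)‖ = c := by rw [RCLike.norm_ofReal, abs_of_nonneg hc0]
  have hcV : ‖(c : 𝕜) • V‖ ≤ c * ‖V‖ :=
    (norm_smul_le (c : 𝕜) V).trans_eq (by rw [hcn])
  have hcV' : ‖(c : 𝕜) • V‖ ≤ ‖V‖ :=
    hcV.trans (mul_le_of_le_one_left (norm_nonneg V) hc1)
  have hW := incl_smul_eq_volterra hV (c : 𝕜)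
  refine ⟨⟨(c : 𝕜) • V, hW, hcV'.trans_lt hV1⟩, ?_⟩
  obtain ⟨S, hS, hSg, hSn⟩ := (isVolterra_of_incl_eq_volterra hA hlam hW
    (hcV'.trans_lt hV1)).exists_perturbedSemigroup ht₀ hA (isResolvent_opResolvent hlam)
  refine ⟨S, ⟨hS, fun x y => ?_⟩, fun t ht => ?_⟩
  · rw [← hSg, mem_perturbedGen_graph_iff hA hlam, resolventComp_apply]
  · have hdiff : ∀ t ∈ Icc 0 t₀, ‖S t - T t‖ ≤ c * K := fun t ht => by
      refine (hSn C hC t ht).trans ?_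
      have h2 : ‖(c : 𝕜) • V‖ ≤ c :=
        hcV.trans (mul_le_of_le_one_right hc0 hV1.le)
      have h3 : 0 < 1 - ‖(c : 𝕜) • V‖ := by linarith
      rw [hK]
      gcongr
    have hSC : ∀ t ∈ Icc 0 t₀, ‖S t‖ ≤ 1 + C + K := fun t ht => by
      have h2 : ‖S t‖ ≤ ‖S t - T t‖ + ‖T t‖ := by
        simpa using norm_add_le (S t - T t) (T t)
      have h3 := hdiff t ht
      have h4 := hC t ht
      nlinarith
    refine (hS.norm_sub_le_of_norm_sub_le hT (by linarith) hN hSC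
      (fun t ht => (hC t ht).trans (by linarith)) hdiff ⟨ht.1, ht.2.trans hτN⟩).trans_eq ?_
    ring

/-- Units are open and inversion is continuous at `1`. -/
theorem exists_forall_inverse_one_sub_smul [CompleteSpace X] (K L : X →L[𝕜] X) {ε : ℝ}
    (hε : 0 < ε) :
    ∀ᶠ c : ℝ in 𝓝 0, ∃ H : X →L[𝕜] X, H * (1 - (c : 𝕜) • K) = 1 ∧
      (1 - (c : 𝕜) • K) * H = 1 ∧ ‖H * L - L‖ ≤ ε := by
  have hc : Tendsto (fun c : ℝ => 1 - (c : 𝕜) • K) (𝓝 0) (𝓝 1) := by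
    have : Continuous fun c : ℝ => 1 - (c : 𝕜) • K := by fun_prop
    simpa using this.tendsto 0
  have hinv : Tendsto (Ring.inverse : (X →L[𝕜] X) → _) (𝓝 1) (𝓝 1) := by
    have := NormedRing.inverse_continuousAt (1 : (X →L[𝕜] X)ˣ)
    rwa [ContinuousAt, Units.val_one, Ring.inverse_one] at this
  have h1 : ∀ᶠ c : ℝ in 𝓝 0, IsUnit (1 - (c : 𝕜) • K) :=
    hc (Units.isOpen.mem_nhds isUnit_one)
  have h2 : Tendsto (fun c : ℝ => ‖Ring.inverse (1 - (c : 𝕜) • K) * L - L‖) (𝓝 0) (𝓝 0) := by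
    have := (((hinv.comp hc).mul_const L).sub_const L).norm
    simpa using this
  filter_upwards [h1, h2.eventually_le_const hε] with c hu hle
  exact ⟨Ring.inverse (1 - (c : 𝕜) • K), Ring.inverse_mul_cancel _ hu,
    Ring.mul_inverse_cancel _ hu, hle⟩

end SampledData

end

theorem theorem3p1 {𝕜 : Type*} [RCLike 𝕜]
    {X : Type*} [NormedAddCommGroup X] [NormedSpace 𝕜 X] [CompleteSpace X]
    {U : Type*} [NormedAddCommGroup U] [NormedSpace 𝕜 U] [CompleteSpace U]
    (A : X →ₗ.[𝕜] X) (T : ℝ → X →L[𝕜] X) (hA : SampledData.Generates A T)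
    (lam : 𝕜) (hlam : lam ∈ SampledData.opResolventSet A)
    (B : U →L[𝕜] SampledData.Extrap A lam) (F : X →L[𝕜] U)
    (t₀ : ℝ) (ht₀ : 0 < t₀)
    (D₀ : X →L[𝕜] SampledData.Extrap A lam)
    (hD₀ : D₀ ∈ SampledData.DeschSchappacher A lam T t₀)
    (τ : ℝ) (hτ : 0 < τ) (ω : ℝ) (hω : 0 ≤ ω)
    (hstab : SampledData.ExpStable A lam T 0 B F τ ω) :
    ∃ cmax : ℝ, 0 < cmax ∧ ∀ c : ℝ, 0 ≤ c → c ≤ cmax →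
      SampledData.ExpStable A lam T ((c : 𝕜) • D₀) B F τ ω := by
  let _ : NormedSpace ℝ X := NormedSpace.restrictScalars ℝ 𝕜 X
  have _ : IsScalarTower ℝ 𝕜 X := RestrictScalars.isScalarTower ℝ 𝕜 X
  obtain ⟨-, T₀, hT₀, M, hM, q₀, hq₀, hsol⟩ := hstab
  have hpow := SampledData.norm_step_pow_le_of_expStable hA hlam hT₀ B F hτ
    (zero_le_one.trans hM) hsol
  -- The stability hypothesis provides some semigroup generated by `A_0 = A`; it must be identified
  -- with `T`, to which the perturbation estimate refers.
  have hTT₀ := fun t (ht : 0 ≤ t) => hA.apply_eq_apply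
    (SampledData.generates_of_generates_perturbedGen_zero hA hlam hT₀) ht
  -- The perturbed systems decay with rate `q`, strictly between `ω` and the nominal `q₀`.
  obtain ⟨q, hq, hqq₀⟩ := exists_between hq₀
  obtain ⟨δ, hδ, hstable⟩ := SampledData.exists_norm_pow_le_of_norm_sub_lt (Real.exp_pos _)
    (Real.exp_lt_exp.2 (by nlinarith : -q₀ * τ < -q * τ)) hpow
  obtain ⟨ε, hε, hstep⟩ := hT₀.isC0Semigroup.exists_norm_step_sub_lt lam
    ((SampledData.resolventComp hA hlam B).comp F) hτ.le hδ
  obtain ⟨C, hC0, hC⟩ :=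
    SampledData.exists_generates_perturbedGen_smul hA hlam ht₀ hD₀ τ
  have hsmall : ∀ᶠ c : ℝ in 𝓝 0, C * c ≤ ε := by
    have : Continuous fun c : ℝ => C * c := by fun_prop
    exact (this.tendsto' 0 0 (mul_zero C)).eventually_le_const hε
  obtain ⟨r, hr, hball⟩ := Metric.eventually_nhds_iff.1
    (hsmall.and (SampledData.exists_forall_inverse_one_sub_smul
      (SampledData.resolventComp hA hlam D₀) ((SampledData.resolventComp hA hlam B).comp F) hε))
  -- The bound `1` is required by the perturbation estimate; `r / 2` keeps `c` strictly inside the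
  -- ball where the remaining smallness conditions hold.
  refine ⟨min 1 (r / 2), by positivity, fun c hc0 hc => ?_⟩
  have hc1 : c ≤ 1 := hc.trans (min_le_left _ _)
  have hcr : c < r := (hc.trans (min_le_right _ _)).trans_lt (half_lt_self hr)
  obtain ⟨hCc, H, hH, hH', hHL⟩ := hball (y := c) (by
    rwa [Real.dist_eq, sub_zero, abs_of_nonneg hc0])
  obtain ⟨hDS, S, hS, hST⟩ := hC c hc0 hc1
  have hsmul : SampledData.resolventComp hA hlam ((c : 𝕜) • D₀) =
      (c : 𝕜) • SampledData.resolventComp hA hlam D₀ :=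
    ContinuousLinearMap.comp_smul _ _ _
  rw [← hsmul] at hH hH'
  obtain ⟨C', hC'0, hC'⟩ := hstable _ (hstep S hS.isC0Semigroup _
    (fun t ht => by rw [← hTT₀ t ht.1]; exact (hST t ht).trans hCc) hHL)
  exact SampledData.expStable_of_norm_pow_le hA hlam ⟨t₀, ht₀, hDS⟩ hH hH' hS B F hτ hω hq hC'0 hC'
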